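/- \textbf{Setting.} A network with $r\ge 1$ queues operates in slots $t=0,1,2,\dots$. The network states $S(t)$ are i.i.d. on a finite set $\mathcal S$ with probabilities $p_s$. In state $s$ the controller chooses an action $x$ from a compact set $\mathcal X^{(s)}$. It has real cost $f(s,x)$, brings $g_j(s,x)\ge 0$ packets to queue $j$ and offers service $b_j(s,x)\ge 0$ to queue $j$, where $|f|,g_j,b_j\le\delta_{max}<\infty$. There are $\epsilon>0$, actions $x^{(s)k}\in\mathcal X^{(s)}$ and weights $\vartheta^{(s)}_k\ge 0$ ($1\le k\le r+2$) with $\sum_k\vartheta^{(s)}_k=1$ for all $s$ and $\sum_s p_s\sum_k\vartheta^{(s)}_k[g_j(s,x^{(s)k})-b_j(s,x^{(s)k})]\le-\epsilon$ for all $j$. With $A_j(t)=g_j(S(t),x(t))$ and $\mu_j(t)=b_j(S(t),x(t))$, backlogs evolve by $U_j(t+1)=\max[U_j(t)-\mu_j(t),0]+A_j(t)$. A policy (possibly randomized and history dependent, but not anticipating future states) is stable if, from $U(0)=0$, $\limsup_{t}\frac1t\sum_{\tau<t}\sum_j E[U_j(\tau)]<\infty$. Its cost is $\limsup_t\frac1t\sum_{\tau<t}E[f(\tau)]$,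 where $f(\tau)=f(S(\tau),x(\tau))$, and $f^*_{av}$ is the infimum of the costs of stable policies. For $V\ge1$ let $$q_V(U)=\inf_{x^{(s)}\in\mathcal X^{(s)}}\sum_s p_s\Big\{Vf(s,x^{(s)})+\sum_jU_j[g_j(s,x^{(s)})-b_j(s,x^{(s)})]\Big\},$$ let $U^*_V$ be a maximizer of $q_V$ over $U\succeq 0$, and write $q_0,U_0^*$ for the case $V=1$. Assume that $q_0$ is locally polyhedral: there are $\epsilon',L>0$ with $q_0(U^*_0)\ge q_0(U)+L\|U^*_0-U\|$ for all $U\succeq0$ with $\|U-U_0^*\|<\epsilon'$ (Euclidean norm). \textbf{FQLA-Ideal.} Put $\mathcal W_j=\max[U^*_{Vj}-\log^2V,0]$, $W_j(0)=\mathcal W_j$, $U_j(0)=0$. In every slot choose $x(t)\in\mathcal X^{(S(t))}$ maximizing $-Vf(S(t),x)+\sum_jW_j(t)[b_j(S(t),x)-g_j(S(t),x)]$ (ties broken in any causal way), let $A(t),\mu(t)$ be its arrivals and services, and update $W_j(t+1)=\max[W_j(t)-\mu_j(t),0]+A_j(t)$ and $U_j(t+1)=\max[U_j(t)-\mu_j(t),0]+\tilde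 A_j(t)$, where $\tilde A_j(t)=A_j(t)$ if $W_j(t)\ge\mathcal W_j$ and $\tilde A_j(t)=\max[A_j(t)-\mathcal W_j+W_j(t),0]$ otherwise. The remaining $A_j(t)-\tilde A_j(t)$ packets are dropped. The cost incurred in slot $t$ is $f(S(t),x(t))$ if $W_j(t)\ge\mathcal W_j$ for all $j$. In the other slots, in which the action is modified, it may be any random quantity of magnitude at most $\delta_{max}$, for instance again $f(S(t),x(t))$. \textbf{Theorem.} There are constants $c_0>0$, $C$ and $V_0\ge1$, depending only on the network data (not on $V$, the probability space or the tie-breaking), such that for every $V\ge V_0$, under FQLA-Ideal: \begin{enumerate} \item $\overline U=\limsup_t\frac1t\sum_{\tau<t}\sum_jE[U_j(\tau)]\le C\log^2V$; \item the average cost $f^{FI}_{av}$ (the limsup of the averages of the expected cost incurred) satisfies $|f^{FI}_{av}-f^*_{av}|\le C/V$; \item the time average of the expected number of packets dropped per slot, $\limsup_t\frac1t\sum_{\tau<t}\sum_jE[A_j(\tau)-\tilde A_j(\tau)]$, is at most $C/V^{c_0\log V}$; and, provided that the expected total number of arrivals $\sum_{\tau<t}\sum_jE[A_j(\tau)]$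 tends to infinity with $t$, the fraction of packets dropped, $P_{drop}=\limsup_t\dfrac{\sum_{\tau<t}\sum_jE[A_j(\tau)-\tilde A_j(\tau)]}{\sum_{\tau<t}\sum_jE[A_j(\tau)]}$, is at most $C/V^{c_0\log V}$. \end{enumerate} -/

import Mathlib

open MeasureTheory ProbabilityTheory Filter Topology
open scoped BigOperators

universe u v w

noncomputable section

/-- The data of a slotted network with `r` queues, a finite set `σ` of network states, and, for
every state `s`, a compact set `X s` of feasible actions.  In state `s` the action `x` has
cost `f s x`, brings `g s x j` packets to queue `j` and offers the service `b s x j` to queue `j`. -/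
structure NetworkModel (r : ℕ) (σ : Type v) (α : Type w) [Fintype σ] [TopologicalSpace α] where
  /-- probabilities of the network states -/
  p : σ → ℝ
  p_nonneg : ∀ s, 0 ≤ p s
  p_sum : ∑ s, p s = 1
  /-- feasible actions -/
  X : σ → Set α
  X_compact : ∀ s, IsCompact (X s)
  /-- cost -/
  f : σ → α → ℝ
  /-- traffic -/
  g : σ → α → Fin r → ℝ
  /-- service -/
  b : σ → α → Fin r → ℝ
  /-- uniform bound on cost, traffic and service -/
  δ : ℝ
  δ_pos : 0 < δ
  f_bound : ∀ s, ∀ x ∈ X s, |f s x| ≤ δ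
  g_nonneg : ∀ s, ∀ x ∈ X s, ∀ j, 0 ≤ g s x j
  g_le : ∀ s, ∀ x ∈ X s, ∀ j, g s x j ≤ δ
  b_nonneg : ∀ s, ∀ x ∈ X s, ∀ j, 0 ≤ b s x j
  b_le : ∀ s, ∀ x ∈ X s, ∀ j, b s x j ≤ δ
  /-- the constraints are feasible with slack, by time sharing over `r + 2` actions per state -/
  slack : ∃ ε : ℝ, 0 < ε ∧ ∃ (a : σ → Fin (r + 2) → α) (θ : σ → Fin (r + 2) → ℝ),
    (∀ s k, a s k ∈ X s) ∧ (∀ s k, 0 ≤ θ s k) ∧ (∀ s, ∑ k, θ s k = 1) ∧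
    ∀ j, ∑ s, p s * ∑ k, θ s k * (g s (a s k) j - b s (a s k) j) ≤ -ε

/-- The average of the first `t` terms of a sequence. -/
def runningAvg (a : ℕ → ℝ) (t : ℕ) : ℝ := (∑ τ ∈ Finset.range t, a τ) / (t : ℝ)

/-- The backlog recursion `U(t+1) = max[U(t) - μ(t), 0] + A(t)`, queue by queue. -/
def backlog {r : ℕ} (U₀ : Fin r → ℝ) (A μ : ℕ → Fin r → ℝ) : ℕ → Fin r → ℝ
  | 0 => U₀
  | t + 1 => fun j => max (backlog U₀ A μ t j - μ t j) 0 + A t j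

namespace NetworkModel

variable {r : ℕ} {σ : Type v} {α : Type w} [Fintype σ] [TopologicalSpace α]

/-- The dual function `q` with parameter `V` (`q₀` is the case `V = 1`): the infimum is over the
choices of one feasible action per network state. -/
def dual (M : NetworkModel r σ α) (V : ℝ) (U : Fin r → ℝ) : ℝ :=
  ⨅ x : (∀ s, M.X s),
    ∑ s, M.p s * (V * M.f s (x s) + ∑ j, U j * (M.g s (x s) j - M.b s (x s) j))

/-- `U` is an optimal Lagrange multiplier: it maximizes the dual function over `U ⪰ 0`. -/
def IsDualOptimal (M : NetworkModel r σ α) (V : ℝ) (U : Fin r → ℝ) : Prop :=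
  (∀ j, 0 ≤ U j) ∧ ∀ U' : Fin r → ℝ, (∀ j, 0 ≤ U' j) → M.dual V U' ≤ M.dual V U

/-- `q₀` is locally polyhedral at `U₀`; the norm is the Euclidean one. -/
def LocallyPolyhedral (M : NetworkModel r σ α) (U₀ : Fin r → ℝ) : Prop :=
  ∃ ε L : ℝ, 0 < ε ∧ 0 < L ∧ ∀ U : Fin r → ℝ, (∀ j, 0 ≤ U j) →
    ‖WithLp.toLp 2 (U - U₀)‖ < ε →
    M.dual 1 U + L * ‖WithLp.toLp 2 (U₀ - U)‖ ≤ M.dual 1 U₀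

/-- In state `s` and with queue sizes `U`, the action `x` solves the maximization problem of QLA. -/
def IsQLAAction (M : NetworkModel r σ α) (V : ℝ) (U : Fin r → ℝ) (s : σ) (x : α) : Prop :=
  x ∈ M.X s ∧ ∀ y ∈ M.X s,
    -V * M.f s y + ∑ j, U j * (M.b s y j - M.g s y j) ≤
      -V * M.f s x + ∑ j, U j * (M.b s x j - M.g s x j)

/-- A (possibly randomized and history dependent) policy, realized on a probability space.
`past t` is the information available before slot `t`.  The state `S t` has law `p` and is
independent of `past t`, and `past (t + 1)` contains `S t`; hence the states are i.i.d.  The action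
`x t` is feasible for the state `S t`, and may depend on the past, on `S t` and on additional
randomness, but not on future states. -/
structure Policy (M : NetworkModel r σ α) {Ω : Type u} [mΩ : MeasurableSpace Ω]
    (P : Measure Ω) where
  S : ℕ → Ω → σ
  x : ℕ → Ω → α
  past : Filtration ℕ mΩ
  S_law : ∀ t s, P (S t ⁻¹' {s}) = ENNReal.ofReal (M.p s)
  S_indep : ∀ t, Indep (past t) (MeasurableSpace.comap (S t) ⊤) P
  S_meas : ∀ t, Measurable[past (t + 1), ⊤] (S t)
  x_mem : ∀ t ω, x t ω ∈ M.X (S t ω)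
  f_meas : ∀ t, Measurable[past (t + 1)] (fun ω => M.f (S t ω) (x t ω))
  g_meas : ∀ t j, Measurable[past (t + 1)] (fun ω => M.g (S t ω) (x t ω) j)
  b_meas : ∀ t j, Measurable[past (t + 1)] (fun ω => M.b (S t ω) (x t ω) j)

namespace Policy

variable {M : NetworkModel r σ α} {Ω : Type u} [MeasurableSpace Ω] {P : Measure Ω}

/-- The arrivals `A(t)` generated by the actions. -/
def A (π : M.Policy P) (ω : Ω) (t : ℕ) (j : Fin r) : ℝ := M.g (π.S t ω) (π.x t ω) j

/-- The services `μ(t)` generated by the actions. -/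
def μ (π : M.Policy P) (ω : Ω) (t : ℕ) (j : Fin r) : ℝ := M.b (π.S t ω) (π.x t ω) j

/-- The cost of the action of slot `t`. -/
def cost (π : M.Policy P) (t : ℕ) (ω : Ω) : ℝ := M.f (π.S t ω) (π.x t ω)

/-- Queue stability, from empty initial queues: the limsup of the average expected total backlog is
finite (the limsup is taken in the extended reals). -/
def Stable (π : M.Policy P) : Prop :=
  limsup (fun t => ((runningAvg
    (fun τ => ∑ j, ∫ ω, backlog 0 (π.A ω) (π.μ ω) τ j ∂P) t : ℝ) : EReal)) atTop < ⊤

/-- The time average cost of a policy (the running averages are bounded by `δ`). -/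
def avgCost (π : M.Policy P) : ℝ :=
  limsup (runningAvg (fun τ => ∫ ω, π.cost τ ω ∂P)) atTop

end Policy

/-- The optimal time average cost over all stable policies, on arbitrary probability spaces. -/
def optCost (M : NetworkModel r σ α) : ℝ :=
  sInf {c : ℝ | ∃ (Ω : Type u) (_ : MeasurableSpace Ω) (P : Measure Ω)
    (_ : IsProbabilityMeasure P) (π : M.Policy P), π.Stable ∧ c = π.avgCost}

end NetworkModel

/-- The number of place-holder bits of each queue, for the multiplier `UV` at parameter `V`. -/
def placeholder {r : ℕ} (V : ℝ) (UV : Fin r → ℝ) (j : Fin r) : ℝ :=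
  max (UV j - Real.log V ^ 2) 0

/-- The admitted arrivals, given place-holder bits `H`, virtual backlog `W` and arrivals `A`. -/
def admitted {r : ℕ} (H W A : Fin r → ℝ) (j : Fin r) : ℝ :=
  if H j ≤ W j then A j else max (A j - H j + W j) 0

namespace NetworkModel

variable {r : ℕ} {σ : Type v} {α : Type w} [Fintype σ] [TopologicalSpace α]

/-- A run of FQLA-Ideal with parameter `V` and known optimal multiplier `UV`: the actions are QLA
actions (ties broken in any causal way) for the virtual backlog, which starts from the place-holder
bits.  The cost incurred is that of the chosen action in every slot in which no virtual backlog is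
below its place-holder level; in the other slots, in which the action is modified, it may be any
random quantity of magnitude at most `δ`, in particular again the cost of the chosen action. -/
structure FQLAIdeal (M : NetworkModel r σ α) (V : ℝ) (UV : Fin r → ℝ)
    {Ω : Type u} [MeasurableSpace Ω] (P : Measure Ω) extends M.Policy P where
  isQLA : ∀ t ω, M.IsQLAAction V
    (backlog (placeholder V UV) (toPolicy.A ω) (toPolicy.μ ω) t) (S t ω) (x t ω)
  incurred : ℕ → Ω → ℝ
  incurred_meas : ∀ t, Measurable (incurred t)
  incurred_bound : ∀ t ω, |incurred t ω| ≤ M.δ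
  incurred_eq : ∀ t ω,
    (∀ j, placeholder V UV j ≤
      backlog (placeholder V UV) (toPolicy.A ω) (toPolicy.μ ω) t j) →
    incurred t ω = toPolicy.cost t ω

namespace FQLAIdeal

variable {M : NetworkModel r σ α} {V : ℝ} {UV : Fin r → ℝ}
  {Ω : Type u} [MeasurableSpace Ω] {P : Measure Ω}

/-- The virtual backlog `W(t)`. -/
def W (R : M.FQLAIdeal V UV P) (ω : Ω) : ℕ → Fin r → ℝ :=
  backlog (placeholder V UV) (R.A ω) (R.μ ω)

/-- The admitted arrivals in slot `t`. -/
def adm (R : M.FQLAIdeal V UV P) (ω : Ω) (t : ℕ) : Fin r → ℝ :=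
  admitted (placeholder V UV) (R.W ω t) (R.A ω t)

/-- The actual backlog `U(t)`, starting from empty queues. -/
def U (R : M.FQLAIdeal V UV P) (ω : Ω) : ℕ → Fin r → ℝ :=
  backlog 0 (R.adm ω) (R.μ ω)

/-- The time average of the expected total backlog, in the extended reals. -/
def avgBacklog (R : M.FQLAIdeal V UV P) : EReal :=
  limsup (fun t => ((runningAvg (fun τ => ∑ j, ∫ ω, R.U ω τ j ∂P) t : ℝ) : EReal)) atTop

/-- The time average of the cost incurred. -/
def avgIncurred (R : M.FQLAIdeal V UV P) : ℝ :=
  limsup (runningAvg (fun τ => ∫ ω, R.incurred τ ω ∂P)) atTop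

/-- The expected number of packets that arrive in slot `t`, over all queues. -/
def arrived (R : M.FQLAIdeal V UV P) (t : ℕ) : ℝ := ∑ j, ∫ ω, R.A ω t j ∂P

/-- The expected number of packets that are dropped in slot `t`, over all queues. -/
def dropped (R : M.FQLAIdeal V UV P) (t : ℕ) : ℝ := ∑ j, ∫ ω, (R.A ω t j - R.adm ω t j) ∂P

/-- The time average number of packets dropped per slot. -/
def dropRate (R : M.FQLAIdeal V UV P) : ℝ := limsup (runningAvg R.dropped) atTop

/-- The long-run fraction of arrived packets that are dropped (a limsup of numbers in `[0, 1]`). -/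
def dropFraction (R : M.FQLAIdeal V UV P) : ℝ :=
  limsup (fun t : ℕ => (∑ τ ∈ Finset.range t, R.dropped τ) / ∑ τ ∈ Finset.range t, R.arrived τ)
    atTop

end FQLAIdeal

end NetworkModel

end

/-! The dual function is concave and scales as `q_V(V U) = V q_0(U)`. Hence local polyhedrality is
global, the maximizer is unique, `U*_V = V U*_0`, and `q_V` falls off from `U*_V` with a slope `L`
that does not depend on `V`. A QLA action minimizes the Lagrangian at the current virtual backlog
`W`, so the expected drift of `|W - U*_V|^2` is at most `2 (q_V(W) - q_V(U*_V))` plus a constant,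
hence at most `-2L |W - U*_V|` plus a constant. With bounded increments this gives negative drift of
`exp (θ |W - U*_V|)` beyond a radius `D`, where `θ` and `D` are free of `V`.

Summing the drift bounds the total of `E[exp (θ |W - U*_V|); |W - U*_V| ≥ D]`
(`sum_integral_expTail_le`). The contribution from inside the radius `D` is charged to arrivals
rather than to slots: the total variation of a queue is at most twice its arrivals plus its initial
content. This is what makes the dropped fraction small even if arrivals are rare.

Everything else is read off this tail. A queue below its place-holder level is at distance at least
`log^2 V` from the multiplier, so drops and modified actions carry a factor `exp (-θ log^2 V) =
V^(-θ log V)`. The real backlog is at most `log^2 V`, a constant and the distance. The cost is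
squeezed between weak duality, which bounds every stable policy below by `q_0(U*_0)`, and drift plus
penalty, which bounds QLA above by `q_0(U*_0) + O(1/V)`. -/

/-! ### Euclidean norm on the space of backlogs -/

/-- The Euclidean norm on `Fin r → ℝ`. -/
noncomputable def euclNorm {r : ℕ} (x : Fin r → ℝ) : ℝ := ‖WithLp.toLp 2 x‖

section EuclNorm

variable {r : ℕ}

lemma euclNorm_nonneg (x : Fin r → ℝ) : 0 ≤ euclNorm x := norm_nonneg _

lemma euclNorm_sq (x : Fin r → ℝ) : euclNorm x ^ 2 = ∑ j, x j ^ 2 := by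
  simp [euclNorm, EuclideanSpace.norm_sq_eq]

lemma abs_le_euclNorm (x : Fin r → ℝ) (j : Fin r) : |x j| ≤ euclNorm x := by
  simpa [euclNorm] using PiLp.norm_apply_le (WithLp.toLp 2 x) j

lemma euclNorm_smul (c : ℝ) (x : Fin r → ℝ) : euclNorm (c • x) = |c| * euclNorm x := by
  simp [euclNorm, WithLp.toLp_smul, norm_smul]

lemma euclNorm_sub_comm (x y : Fin r → ℝ) : euclNorm (x - y) = euclNorm (y - x) := by
  simp only [euclNorm, WithLp.toLp_sub]
  exact norm_sub_rev _ _

lemma abs_euclNorm_sub_le (x y : Fin r → ℝ) : |euclNorm x - euclNorm y| ≤ euclNorm (x - y) := by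
  simp only [euclNorm, WithLp.toLp_sub]
  exact abs_norm_sub_norm_le _ _

lemma euclNorm_le_sum_abs (x : Fin r → ℝ) : euclNorm x ≤ ∑ j, |x j| := by
  refine abs_le_of_sq_le_sq' ?_ (Finset.sum_nonneg fun _ _ => abs_nonneg _) |>.2
  rw [euclNorm_sq]
  calc ∑ j, x j ^ 2 = ∑ j, |x j| ^ 2 := by simp
    _ ≤ (∑ j, |x j|) ^ 2 := Finset.sum_sq_le_sq_sum_of_nonneg fun _ _ => abs_nonneg _

lemma eq_of_euclNorm_sub_le_zero {x y : Fin r → ℝ} (h : euclNorm (x - y) ≤ 0) : x = y := by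
  funext j
  have h1 := (abs_le_euclNorm (x - y) j).trans h
  have h2 := abs_nonpos_iff.1 h1
  simpa [sub_eq_zero] using h2

lemma continuous_euclNorm : Continuous (euclNorm : (Fin r → ℝ) → ℝ) := by
  unfold euclNorm
  fun_prop

end EuclNorm

/-! ### Dual function: splitting over states, concavity, scaling, polyhedrality -/

namespace NetworkModel

variable {r : ℕ} {σ : Type v} {α : Type w} [Fintype σ] [TopologicalSpace α]

lemma nonempty_X (M : NetworkModel r σ α) (s : σ) : Nonempty (M.X s) := by
  obtain ⟨_, _, a, _, ha, _⟩ := M.slack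
  exact ⟨⟨a s 0, ha s 0⟩⟩

/-- The penalized cost of the action `x` in state `s` for the multiplier `U`. -/
noncomputable def lagr (M : NetworkModel r σ α) (V : ℝ) (U : Fin r → ℝ) (s : σ) (x : α) : ℝ :=
  V * M.f s x + ∑ j, U j * (M.g s x j - M.b s x j)

/-- The least penalized cost in state `s` for the multiplier `U`. -/
noncomputable def stateDual (M : NetworkModel r σ α) (V : ℝ) (U : Fin r → ℝ) (s : σ) : ℝ :=
  ⨅ x : M.X s, M.lagr V U s x

lemma abs_drift_le (M : NetworkModel r σ α) {s : σ} {x : α} (hx : x ∈ M.X s) (j : Fin r) :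
    |M.g s x j - M.b s x j| ≤ M.δ := by
  rw [abs_le]
  constructor <;>
  linarith [M.g_nonneg s x hx j, M.g_le s x hx j, M.b_nonneg s x hx j, M.b_le s x hx j]

lemma abs_lagr_le (M : NetworkModel r σ α) (V : ℝ) (U : Fin r → ℝ) {s : σ} {x : α}
    (hx : x ∈ M.X s) : |M.lagr V U s x| ≤ |V| * M.δ + ∑ j, |U j| * M.δ := by
  unfold lagr
  refine (abs_add_le _ _).trans (add_le_add ?_ ((Finset.abs_sum_le_sum_abs _ _).trans ?_))
  · rw [abs_mul]
    exact mul_le_mul_of_nonneg_left (M.f_bound s x hx) (abs_nonneg _)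
  · refine Finset.sum_le_sum fun j _ => ?_
    rw [abs_mul]
    exact mul_le_mul_of_nonneg_left (M.abs_drift_le hx j) (abs_nonneg _)

lemma bddBelow_lagr (M : NetworkModel r σ α) (V : ℝ) (U : Fin r → ℝ) (s : σ) :
    BddBelow (Set.range fun x : M.X s => M.lagr V U s x) := by
  refine ⟨-(|V| * M.δ + ∑ j, |U j| * M.δ), ?_⟩
  rintro _ ⟨x, rfl⟩
  exact (abs_le.1 (M.abs_lagr_le V U x.2)).1

lemma stateDual_le (M : NetworkModel r σ α) (V : ℝ) (U : Fin r → ℝ) {s : σ} {x : α}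
    (hx : x ∈ M.X s) : M.stateDual V U s ≤ M.lagr V U s x :=
  ciInf_le (M.bddBelow_lagr V U s) ⟨x, hx⟩

lemma abs_stateDual_le (M : NetworkModel r σ α) (V : ℝ) (U : Fin r → ℝ) (s : σ) :
    |M.stateDual V U s| ≤ |V| * M.δ + ∑ j, |U j| * M.δ := by
  have := M.nonempty_X s
  rw [abs_le]
  constructor
  · exact le_ciInf fun x => (abs_le.1 (M.abs_lagr_le V U x.2)).1
  · obtain ⟨x⟩ := M.nonempty_X s
    exact (M.stateDual_le V U x.2).trans (abs_le.1 (M.abs_lagr_le V U x.2)).2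

/-- Each Lagrangian is affine in the multiplier with coefficients at most `δ`, and an infimum of
such functions keeps the Lipschitz bound. Continuity, hence measurability along the trajectory,
follows without any regularity of the costs in the action. -/
lemma stateDual_le_add (M : NetworkModel r σ α) (V : ℝ) (U U' : Fin r → ℝ) (s : σ) :
    M.stateDual V U s ≤ M.stateDual V U' s + ∑ j, |U j - U' j| * M.δ := by
  have := M.nonempty_X s
  rw [← sub_le_iff_le_add]
  refine le_ciInf fun x => ?_
  rw [sub_le_iff_le_add]
  refine (M.stateDual_le V U x.2).trans ?_
  unfold lagr
  rw [add_assoc, ← Finset.sum_add_distrib]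
  gcongr with j
  have h1 := mul_le_mul_of_nonneg_left (M.abs_drift_le x.2 j) (abs_nonneg (U j - U' j))
  rw [← abs_mul] at h1
  nlinarith [le_abs_self ((U j - U' j) * (M.g s x j - M.b s x j))]

lemma continuous_stateDual (M : NetworkModel r σ α) (V : ℝ) (s : σ) :
    Continuous fun U => M.stateDual V U s := by
  rw [continuous_iff_continuousAt]
  intro U
  have h0 : Tendsto (fun U' : Fin r → ℝ => ∑ j, |U' j - U j| * M.δ) (𝓝 U) (𝓝 0) := by
    have hc : Continuous fun U' : Fin r → ℝ => ∑ j, |U' j - U j| * M.δ := by fun_prop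
    simpa using hc.tendsto U
  rw [ContinuousAt, tendsto_iff_dist_tendsto_zero]
  refine squeeze_zero (fun _ => dist_nonneg) (fun U' => ?_) h0
  rw [Real.dist_eq, abs_le]
  have h1 := M.stateDual_le_add V U' U s
  have h2 := M.stateDual_le_add V U U' s
  simp_rw [abs_sub_comm (U _)] at h2
  constructor <;> linarith

lemma stateDual_eq_of_isQLAAction (M : NetworkModel r σ α) {V : ℝ} {U : Fin r → ℝ} {s : σ} {x : α}
    (h : M.IsQLAAction V U s x) : M.lagr V U s x = M.stateDual V U s := by
  have := M.nonempty_X s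
  refine le_antisymm (le_ciInf fun y => ?_) (M.stateDual_le V U h.1)
  have h1 := h.2 y y.2
  have h2 : ∀ z, ∑ j, U j * (M.b s z j - M.g s z j) = -∑ j, U j * (M.g s z j - M.b s z j) := by
    intro z
    rw [← Finset.sum_neg_distrib]
    exact Finset.sum_congr rfl fun j _ => by ring
  rw [h2, h2] at h1
  unfold lagr
  linarith

lemma dual_eq_iInf (M : NetworkModel r σ α) (V : ℝ) (U : Fin r → ℝ) :
    M.dual V U = ⨅ x : (∀ s, M.X s), ∑ s, M.p s * M.lagr V U s (x s) := rfl

lemma sum_stateDual_le (M : NetworkModel r σ α) (V : ℝ) (U : Fin r → ℝ) (x : ∀ s, M.X s) :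
    ∑ s, M.p s * M.stateDual V U s ≤ ∑ s, M.p s * M.lagr V U s (x s) :=
  Finset.sum_le_sum fun s _ =>
    mul_le_mul_of_nonneg_left (M.stateDual_le V U (x s).2) (M.p_nonneg s)

lemma bddBelow_dual (M : NetworkModel r σ α) (V : ℝ) (U : Fin r → ℝ) :
    BddBelow (Set.range fun x : (∀ s, M.X s) => ∑ s, M.p s * M.lagr V U s (x s)) := by
  refine ⟨∑ s, M.p s * M.stateDual V U s, ?_⟩
  rintro _ ⟨x, rfl⟩
  exact M.sum_stateDual_le V U x

/-- The infimum over joint choices decouples, since each summand involves the action of one state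
only. Near-minimizers are used because the infimum need not be attained. -/
lemma dual_eq_sum (M : NetworkModel r σ α) (V : ℝ) (U : Fin r → ℝ) :
    M.dual V U = ∑ s, M.p s * M.stateDual V U s := by
  have := M.nonempty_X
  rw [dual_eq_iInf]
  refine le_antisymm (le_of_forall_pos_le_add fun ε hε => ?_)
    (le_ciInf fun x => M.sum_stateDual_le V U x)
  have hx : ∀ s, ∃ x : M.X s, M.lagr V U s x < M.stateDual V U s + ε := fun s =>
    exists_lt_of_ciInf_lt (lt_add_of_pos_right _ hε)
  choose x hx using hx
  refine (ciInf_le (M.bddBelow_dual V U) x).trans ?_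
  calc ∑ s, M.p s * M.lagr V U s (x s)
      ≤ ∑ s, M.p s * (M.stateDual V U s + ε) :=
        Finset.sum_le_sum fun s _ => mul_le_mul_of_nonneg_left (hx s).le (M.p_nonneg s)
    _ = _ := by simp only [mul_add, Finset.sum_add_distrib, ← Finset.sum_mul, M.p_sum, one_mul]

/-- An infimum of functions affine in the multiplier is concave. -/
lemma dual_concave (M : NetworkModel r σ α) (V : ℝ) (U U' : Fin r → ℝ) {c : ℝ} (h0 : 0 ≤ c)
    (h1 : c ≤ 1) :
    (1 - c) * M.dual V U + c * M.dual V U' ≤ M.dual V (U + c • (U' - U)) := by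
  have := M.nonempty_X
  rw [M.dual_eq_iInf V (U + c • (U' - U))]
  refine le_ciInf fun x => ?_
  have e : ∑ s, M.p s * M.lagr V (U + c • (U' - U)) s (x s) =
      (1 - c) * (∑ s, M.p s * M.lagr V U s (x s)) + c * ∑ s, M.p s * M.lagr V U' s (x s) := by
    rw [Finset.mul_sum, Finset.mul_sum, ← Finset.sum_add_distrib]
    refine Finset.sum_congr rfl fun s _ => ?_
    have : ∑ j, (U + c • (U' - U)) j * (M.g s (x s) j - M.b s (x s) j) =
        (1 - c) * (∑ j, U j * (M.g s (x s) j - M.b s (x s) j)) +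
          c * ∑ j, U' j * (M.g s (x s) j - M.b s (x s) j) := by
      rw [Finset.mul_sum, Finset.mul_sum, ← Finset.sum_add_distrib]
      refine Finset.sum_congr rfl fun j _ => ?_
      simp only [Pi.add_apply, Pi.smul_apply, Pi.sub_apply, smul_eq_mul]
      ring
    unfold lagr
    rw [this]
    ring
  rw [e]
  exact add_le_add
    (mul_le_mul_of_nonneg_left (ciInf_le (M.bddBelow_dual V U) x) (sub_nonneg.2 h1))
    (mul_le_mul_of_nonneg_left (ciInf_le (M.bddBelow_dual V U') x) h0)

lemma dual_smul (M : NetworkModel r σ α) {V : ℝ} (hV : 0 ≤ V) (U : Fin r → ℝ) :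
    M.dual V (V • U) = V * M.dual 1 U := by
  rw [dual_eq_iInf, dual_eq_iInf, Real.mul_iInf_of_nonneg hV]
  congr 1
  funext x
  rw [Finset.mul_sum]
  refine Finset.sum_congr rfl fun s _ => ?_
  simp only [lagr, Pi.smul_apply, smul_eq_mul, mul_add, Finset.mul_sum]
  congr 1
  · ring
  · exact Finset.sum_congr rfl fun j _ => by ring

/-- By concavity, a locally polyhedral dual function is polyhedral on the whole orthant. -/
lemma LocallyPolyhedral.global {M : NetworkModel r σ α} {U₀ : Fin r → ℝ}
    (h : M.LocallyPolyhedral U₀) (hU₀ : ∀ j, 0 ≤ U₀ j) :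
    ∃ L : ℝ, 0 < L ∧ ∀ U : Fin r → ℝ, (∀ j, 0 ≤ U j) →
      M.dual 1 U + L * euclNorm (U - U₀) ≤ M.dual 1 U₀ := by
  obtain ⟨ε, L, hε, hL, h⟩ := h
  refine ⟨L, hL, fun U hU => ?_⟩
  set n := euclNorm (U - U₀) with hn
  have hn0 : 0 ≤ n := euclNorm_nonneg _
  -- Shrink the segment from `U₀` to `U` until its endpoint lies in the ball where polyhedrality is
  -- known. The `n + 1` covers `n = 0` and makes the inequality strict.
  obtain ⟨c, hc0, hc1, hcn⟩ : ∃ c : ℝ, 0 < c ∧ c ≤ 1 ∧ c * n < ε := by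
    refine ⟨min 1 (ε / (n + 1)), lt_min one_pos (by positivity), min_le_left _ _, ?_⟩
    calc min 1 (ε / (n + 1)) * n ≤ ε / (n + 1) * n :=
          mul_le_mul_of_nonneg_right (min_le_right _ _) hn0
      _ < ε := by
          rw [div_mul_eq_mul_div, div_lt_iff₀ (by positivity)]
          nlinarith
  have e : euclNorm (U₀ + c • (U - U₀) - U₀) = c * n := by
    rw [add_sub_cancel_left, euclNorm_smul, abs_of_pos hc0]
  have h1 := h (U₀ + c • (U - U₀)) (fun j => by
    simp only [Pi.add_apply, Pi.smul_apply, Pi.sub_apply, smul_eq_mul]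
    nlinarith [mul_nonneg hc0.le (hU j), mul_nonneg (sub_nonneg.2 hc1) (hU₀ j)])
    (by change euclNorm _ < ε; rw [e]; exact hcn)
  change _ + L * euclNorm (U₀ - (U₀ + c • (U - U₀))) ≤ _ at h1
  rw [euclNorm_sub_comm, e] at h1
  have h2 := M.dual_concave 1 U₀ U hc0.le hc1
  -- The local bound at the shrunk point, compared with the chord below the concave function there;
  -- the factor `c` then cancels.
  have h3 : c * (M.dual 1 U + L * n - M.dual 1 U₀) ≤ 0 := by nlinarith
  by_contra! hlt
  nlinarith [mul_pos hc0 (sub_pos.2 hlt)]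

/-- The optimal multiplier for `V` is `V` times the one for `1`, and the dual function with
parameter `V` is polyhedral with the same slope. -/
lemma IsDualOptimal.polyhedral {M : NetworkModel r σ α} {U₀ : Fin r → ℝ} {L : ℝ}
    (hU₀ : ∀ j, 0 ≤ U₀ j) (hL : 0 < L)
    (h : ∀ U : Fin r → ℝ, (∀ j, 0 ≤ U j) → M.dual 1 U + L * euclNorm (U - U₀) ≤ M.dual 1 U₀)
    {V : ℝ} (hV : 0 < V) {UV : Fin r → ℝ} (hUV : M.IsDualOptimal V UV) :
    M.dual V UV = V * M.dual 1 U₀ ∧ ∀ U : Fin r → ℝ, (∀ j, 0 ≤ U j) →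
      M.dual V U + L * euclNorm (U - UV) ≤ M.dual V UV := by
  have hscale : ∀ U : Fin r → ℝ, M.dual V U = V * M.dual 1 (V⁻¹ • U) := by
    intro U
    rw [← M.dual_smul hV.le, smul_smul, mul_inv_cancel₀ hV.ne', one_smul]
  have hpos : ∀ U : Fin r → ℝ, (∀ j, 0 ≤ U j) → ∀ j, 0 ≤ (V⁻¹ • U) j := fun U hU j =>
    mul_nonneg (inv_nonneg.2 hV.le) (hU j)
  -- The rescaled optimum also maximizes `q_0`, and the positive slope allows only one maximizer.
  have key : V⁻¹ • UV = U₀ := by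
    apply eq_of_euclNorm_sub_le_zero
    have h1 := h _ (hpos UV hUV.1)
    have h2 := hUV.2 (V • U₀) (fun j => mul_nonneg hV.le (hU₀ j))
    rw [M.dual_smul hV.le, hscale UV] at h2
    have h3 := le_of_mul_le_mul_left h2 hV
    by_contra! hlt
    nlinarith [mul_pos hL hlt]
  refine ⟨by rw [hscale, key], fun U hU => ?_⟩
  have h1 := h _ (hpos U hU)
  have e : euclNorm (U - UV) = V * euclNorm (V⁻¹ • U - U₀) := by
    rw [← key, ← smul_sub, euclNorm_smul, abs_of_pos (inv_pos.2 hV)]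
    field_simp
  rw [hscale U, hscale UV, key, e]
  nlinarith

end NetworkModel

/-! ### One slot of a single queue -/

lemma abs_max_sub_add_sub_le {w a m δ : ℝ} (hw : 0 ≤ w) (ha : 0 ≤ a) (haδ : a ≤ δ) (hm : 0 ≤ m)
    (hmδ : m ≤ δ) : |max (w - m) 0 + a - w| ≤ δ := by
  rw [abs_le]
  rcases le_total (w - m) 0 with h | h
  · rw [max_eq_right h]; constructor <;> linarith
  · rw [max_eq_left h]; constructor <;> linarith

/-- When the queue empties, replacing `w - m` by `0` costs `2 (w - u)(m - w)`. Its part with `u` has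
the good sign because `u ≥ 0`, and its part with `w` is at most `2δ^2`; the squared increment adds
one more `δ^2`. -/
lemma sq_max_sub_add_sub_le {w a m u δ : ℝ} (hw : 0 ≤ w) (hu : 0 ≤ u) (ha : 0 ≤ a) (haδ : a ≤ δ)
    (hm : 0 ≤ m) (hmδ : m ≤ δ) :
    (max (w - m) 0 + a - u) ^ 2 ≤ (w - u) ^ 2 + 2 * ((w - u) * (a - m)) + 3 * δ ^ 2 := by
  rcases le_total (w - m) 0 with h | h
  · rw [max_eq_right h]
    have h1 : (a - w) ^ 2 ≤ δ ^ 2 := sq_le_sq' (by linarith) (by linarith)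
    have h2 : w * (m - w) ≤ δ * δ :=
      mul_le_mul (by linarith) (by linarith) (by linarith) (by linarith)
    nlinarith [mul_nonneg hu (sub_nonneg.2 h)]
  · rw [max_eq_left h]
    have h1 : (a - m) ^ 2 ≤ δ ^ 2 := sq_le_sq' (by linarith) (by linarith)
    nlinarith

lemma integrable_of_abs_le {Ω : Type*} [MeasurableSpace Ω] {P : Measure Ω} [IsFiniteMeasure P]
    {F : Ω → ℝ} (hF : Measurable F) {C : ℝ}
    (h : ∀ ω, |F ω| ≤ C) : Integrable F P :=
  Integrable.of_bound hF.aestronglyMeasurable C (Eventually.of_forall h)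

lemma backlog_mono {r : ℕ} {H H' : Fin r → ℝ} (h : ∀ j, H j ≤ H' j) (A m : ℕ → Fin r → ℝ) (t : ℕ)
    (j : Fin r) : backlog H A m t j ≤ backlog H' A m t j := by
  induction t with
  | zero => exact h j
  | succ t ih => exact add_le_add_left (max_le_max_right _ (sub_le_sub_right ih _)) _

/-! ### Backlogs under a policy: pathwise bounds, measurability, independence -/

namespace NetworkModel.Policy

variable {r : ℕ} {σ : Type v} {α : Type w} [Fintype σ] [TopologicalSpace α]
  {M : NetworkModel r σ α} {Ω : Type u} [MeasurableSpace Ω] {P : Measure Ω}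

/-- The backlog under a policy, from the initial backlog `H`. -/
def queue (π : M.Policy P) (H : Fin r → ℝ) (t : ℕ) (ω : Ω) : Fin r → ℝ :=
  backlog H (π.A ω) (π.μ ω) t

section Pathwise

variable (π : M.Policy P) (H : Fin r → ℝ)

lemma A_nonneg (ω : Ω) (t : ℕ) (j : Fin r) : 0 ≤ π.A ω t j := M.g_nonneg _ _ (π.x_mem t ω) j
lemma A_le (ω : Ω) (t : ℕ) (j : Fin r) : π.A ω t j ≤ M.δ := M.g_le _ _ (π.x_mem t ω) j
lemma μ_nonneg (ω : Ω) (t : ℕ) (j : Fin r) : 0 ≤ π.μ ω t j := M.b_nonneg _ _ (π.x_mem t ω) j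
lemma μ_le (ω : Ω) (t : ℕ) (j : Fin r) : π.μ ω t j ≤ M.δ := M.b_le _ _ (π.x_mem t ω) j
lemma abs_cost_le (t : ℕ) (ω : Ω) : |π.cost t ω| ≤ M.δ := M.f_bound _ _ (π.x_mem t ω)

lemma queue_succ (t : ℕ) (ω : Ω) (j : Fin r) :
    π.queue H (t + 1) ω j = max (π.queue H t ω j - π.μ ω t j) 0 + π.A ω t j := rfl

variable {H}

lemma queue_nonneg (hH : ∀ j, 0 ≤ H j) (t : ℕ) (ω : Ω) (j : Fin r) : 0 ≤ π.queue H t ω j := by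
  cases t with
  | zero => exact hH j
  | succ t => exact add_nonneg (le_max_right _ _) (π.A_nonneg ω t j)

lemma abs_queue_succ_sub_le (hH : ∀ j, 0 ≤ H j) (t : ℕ) (ω : Ω) (j : Fin r) :
    |π.queue H (t + 1) ω j - π.queue H t ω j| ≤ M.δ :=
  abs_max_sub_add_sub_le (π.queue_nonneg hH t ω j) (π.A_nonneg ω t j) (π.A_le ω t j)
    (π.μ_nonneg ω t j) (π.μ_le ω t j)

/-- A queue rises by at most its arrivals, so its variation is controlled by arrivals minus the net
change. The net change telescopes over time, leaving only arrivals and the initial backlog. -/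
lemma abs_queue_succ_sub_le_flow (hH : ∀ j, 0 ≤ H j) (t : ℕ) (ω : Ω) (j : Fin r) :
    |π.queue H (t + 1) ω j - π.queue H t ω j| ≤
      2 * π.A ω t j - (π.queue H (t + 1) ω j - π.queue H t ω j) := by
  have h0 := π.queue_nonneg hH t ω j
  have h1 := π.A_nonneg ω t j
  have h2 := π.μ_nonneg ω t j
  rw [queue_succ, abs_le]
  rcases le_total (π.queue H t ω j - π.μ ω t j) 0 with h | h
  · rw [max_eq_right h]; constructor <;> linarith
  · rw [max_eq_left h]; constructor <;> linarith

lemma queue_le (hH : ∀ j, 0 ≤ H j) (t : ℕ) (ω : Ω) (j : Fin r) :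
    π.queue H t ω j ≤ H j + t * M.δ := by
  induction t with
  | zero => simp [queue, backlog]
  | succ t ih =>
    have h := (abs_le.1 (π.abs_queue_succ_sub_le hH t ω j)).2
    push_cast
    linarith

lemma euclNorm_queue_succ_sub_le (hH : ∀ j, 0 ≤ H j) (t : ℕ) (ω : Ω) :
    euclNorm (π.queue H (t + 1) ω - π.queue H t ω) ≤ r * M.δ := by
  refine (euclNorm_le_sum_abs _).trans ?_
  calc _ ≤ ∑ _j : Fin r, M.δ := Finset.sum_le_sum fun j _ => π.abs_queue_succ_sub_le hH t ω j
    _ = r * M.δ := by simp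

/-- At a fixed time the backlog ranges in a compact box, so continuous functions of it are bounded
and thus integrable. -/
lemma exists_bound_comp_queue (hH : ∀ j, 0 ≤ H j) (t : ℕ) {F : (Fin r → ℝ) → ℝ}
    (hF : Continuous F) : ∃ C, ∀ ω, |F (π.queue H t ω)| ≤ C := by
  have hc : IsCompact (Set.Icc (0 : Fin r → ℝ) (fun j => H j + t * M.δ)) := isCompact_Icc
  obtain ⟨C, hC⟩ := hc.exists_bound_of_continuousOn hF.continuousOn
  exact ⟨C, fun ω => hC _ ⟨fun j => π.queue_nonneg hH t ω j, fun j => π.queue_le hH t ω j⟩⟩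

lemma exists_bound_stateDual {H : Fin r → ℝ} (hH : ∀ j, 0 ≤ H j) (V : ℝ) (t : ℕ) :
    ∃ C, ∀ s ω, |M.stateDual V (π.queue H t ω) s| ≤ C := by
  choose C hC using fun s => π.exists_bound_comp_queue hH t (M.continuous_stateDual V s)
  exact ⟨∑ s, |C s|, fun s ω => (hC s ω).trans ((le_abs_self _).trans
    (Finset.single_le_sum (f := fun s => |C s|) (fun _ _ => abs_nonneg _) (Finset.mem_univ s)))⟩

/-- One step of the quadratic Lyapunov function around `u` under a QLA action. -/
lemma sq_euclNorm_queue_succ_sub_le (hH : ∀ j, 0 ≤ H j) {V : ℝ} {t : ℕ} {ω : Ω}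
    (hQ : M.IsQLAAction V (π.queue H t ω) (π.S t ω) (π.x t ω)) {u : Fin r → ℝ}
    (hu : ∀ j, 0 ≤ u j) :
    euclNorm (π.queue H (t + 1) ω - u) ^ 2 ≤ euclNorm (π.queue H t ω - u) ^ 2 +
      2 * (M.stateDual V (π.queue H t ω) (π.S t ω) - M.lagr V u (π.S t ω) (π.x t ω)) +
      3 * r * M.δ ^ 2 := by
  rw [← M.stateDual_eq_of_isQLAAction hQ, euclNorm_sq, euclNorm_sq]
  have e : M.lagr V (π.queue H t ω) (π.S t ω) (π.x t ω) - M.lagr V u (π.S t ω) (π.x t ω) =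
      ∑ j, (π.queue H t ω j - u j) * (π.A ω t j - π.μ ω t j) := by
    unfold lagr
    rw [add_sub_add_left_eq_sub, ← Finset.sum_sub_distrib]
    exact Finset.sum_congr rfl fun j _ => by unfold A μ; ring
  have e3 : 3 * r * M.δ ^ 2 = ∑ _j : Fin r, 3 * M.δ ^ 2 := by simp; ring
  rw [e, e3, Finset.mul_sum, ← Finset.sum_add_distrib, ← Finset.sum_add_distrib]
  exact Finset.sum_le_sum fun j _ => sq_max_sub_add_sub_le (π.queue_nonneg hH t ω j) (hu j)
    (π.A_nonneg ω t j) (π.A_le ω t j) (π.μ_nonneg ω t j) (π.μ_le ω t j)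

end Pathwise

section Measurability

variable (π : M.Policy P)

lemma measurable_queue_past (H : Fin r → ℝ) (t : ℕ) : Measurable[π.past t] (π.queue H t) := by
  induction t with
  | zero => exact measurable_const
  | succ t ih =>
    have ih' : Measurable[π.past (t + 1)] (π.queue H t) :=
      ih.mono (π.past.mono t.le_succ) le_rfl
    refine @measurable_pi_lambda _ _ _ (π.past (t + 1)) _ _ fun j => ?_
    have h1 : Measurable[π.past (t + 1)] fun ω => π.queue H t ω j := (measurable_pi_apply j).comp ih'
    exact ((h1.sub (π.b_meas t j)).max measurable_const).add (π.g_meas t j)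

lemma measurable_queue (H : Fin r → ℝ) (t : ℕ) : Measurable (π.queue H t) :=
  (π.measurable_queue_past H t).mono (π.past.le t) le_rfl

lemma measurable_A (t : ℕ) (j : Fin r) : Measurable fun ω => π.A ω t j :=
  (π.g_meas t j).mono (π.past.le _) le_rfl

lemma measurable_cost (t : ℕ) : Measurable (π.cost t) :=
  (π.f_meas t).mono (π.past.le _) le_rfl

lemma measurableSet_S (t : ℕ) (s : σ) : MeasurableSet (π.S t ⁻¹' {s}) :=
  π.past.le (t + 1) _ (π.S_meas t (MeasurableSpace.measurableSet_top))

lemma comp_S_eq_sum [DecidableEq σ] (t : ℕ) (h : σ → Ω → ℝ) (ω : Ω) :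
    h (π.S t ω) ω = ∑ s, h s ω * (π.S t ⁻¹' {s}).indicator 1 ω := by
  rw [Finset.sum_eq_single (π.S t ω)]
  · simp
  · intro s _ hs
    rw [Set.indicator_of_notMem (by simpa using hs.symm), mul_zero]
  · simp

lemma measurable_comp_S (t : ℕ) {h : σ → Ω → ℝ} (hm : ∀ s, Measurable (h s)) :
    Measurable fun ω => h (π.S t ω) ω := by
  classical
  simp_rw [π.comp_S_eq_sum t h]
  exact Finset.measurable_sum _ fun s _ =>
    (hm s).mul (measurable_one.indicator (π.measurableSet_S t s))

variable [IsProbabilityMeasure P]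

/-- The current state is independent of the past. -/
lemma integral_comp_S (t : ℕ) {h : σ → Ω → ℝ} (hm : ∀ s, Measurable[π.past t] (h s)) {C : ℝ}
    (hC : ∀ s ω, |h s ω| ≤ C) :
    ∫ ω, h (π.S t ω) ω ∂P = ∑ s, M.p s * ∫ ω, h s ω ∂P := by
  classical
  have hm' : ∀ s, Measurable (h s) := fun s => (hm s).mono (π.past.le t) le_rfl
  simp_rw [π.comp_S_eq_sum t h]
  have hind : ∀ s, Measurable ((π.S t ⁻¹' {s}).indicator (1 : Ω → ℝ)) := fun s =>
    measurable_one.indicator (π.measurableSet_S t s)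
  rw [integral_finsetSum]
  · refine Finset.sum_congr rfl fun s _ => ?_
    -- `h s` is known before slot `t`, while the indicator is a function of `S t` alone.
    have hi : IndepFun (h s) ((π.S t ⁻¹' {s}).indicator (1 : Ω → ℝ)) P := by
      rw [IndepFun_iff_Indep]
      refine indep_of_indep_of_le_right (indep_of_indep_of_le_left (π.S_indep t) (hm s).comap_le) ?_
      have : Measurable[MeasurableSpace.comap (π.S t) ⊤]
          ((π.S t ⁻¹' {s}).indicator (1 : Ω → ℝ)) :=
        Measurable.indicator measurable_const ⟨{s}, MeasurableSpace.measurableSet_top, rfl⟩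
      exact this.comap_le
    rw [hi.integral_fun_mul_eq_mul_integral (hm' s).aestronglyMeasurable
      (hind s).aestronglyMeasurable, integral_indicator_one (π.measurableSet_S t s),
      Measure.real, π.S_law, ENNReal.toReal_ofReal (M.p_nonneg s), mul_comm]
  · intro s _
    refine integrable_of_abs_le ((hm' s).mul (hind s)) (C := C) fun ω => ?_
    rw [abs_mul]
    refine (mul_le_of_le_one_right (abs_nonneg _) ?_).trans (hC s ω)
    by_cases hω : ω ∈ π.S t ⁻¹' {s} <;> simp [Set.indicator, hω]

lemma integrable_A (t : ℕ) (j : Fin r) : Integrable (fun ω => π.A ω t j) P :=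
  integrable_of_abs_le (π.measurable_A t j) fun ω => by
    rw [abs_of_nonneg (π.A_nonneg ω t j)]; exact π.A_le ω t j

lemma integrable_cost (t : ℕ) : Integrable (π.cost t) P :=
  integrable_of_abs_le (π.measurable_cost t) (π.abs_cost_le t)

lemma integrable_comp_queue {H : Fin r → ℝ} (hH : ∀ j, 0 ≤ H j) (t : ℕ) {F : (Fin r → ℝ) → ℝ}
    (hF : Continuous F) : Integrable (fun ω => F (π.queue H t ω)) P := by
  obtain ⟨C, hC⟩ := π.exists_bound_comp_queue hH t hF
  exact integrable_of_abs_le (hF.measurable.comp (π.measurable_queue H t)) hC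

lemma integrable_queue {H : Fin r → ℝ} (hH : ∀ j, 0 ≤ H j) (t : ℕ) (j : Fin r) :
    Integrable (fun ω => π.queue H t ω j) P :=
  π.integrable_comp_queue hH t (continuous_apply j)

lemma abs_integral_cost_le (t : ℕ) : |∫ ω, π.cost t ω ∂P| ≤ M.δ := by
  simpa using norm_integral_le_of_norm_le_const (μ := P) (f := π.cost t)
    (Eventually.of_forall (π.abs_cost_le t))

lemma integrable_stateDual (H : Fin r → ℝ) (hH : ∀ j, 0 ≤ H j) (V : ℝ) (t : ℕ) :
    Integrable (fun ω => M.stateDual V (π.queue H t ω) (π.S t ω)) P := by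
  obtain ⟨C, hC⟩ := π.exists_bound_stateDual hH V t
  exact integrable_of_abs_le (π.measurable_comp_S t
    (h := fun s ω => M.stateDual V (π.queue H t ω) s) fun s =>
    (M.continuous_stateDual V s).measurable.comp (π.measurable_queue H t)) fun ω => hC _ ω

lemma integral_stateDual (H : Fin r → ℝ) (hH : ∀ j, 0 ≤ H j) (V : ℝ) (t : ℕ) :
    ∫ ω, M.stateDual V (π.queue H t ω) (π.S t ω) ∂P = ∫ ω, M.dual V (π.queue H t ω) ∂P := by
  obtain ⟨C, hC⟩ := π.exists_bound_stateDual hH V t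
  rw [π.integral_comp_S t (h := fun s ω => M.stateDual V (π.queue H t ω) s)
    (fun s => (M.continuous_stateDual V s).measurable.comp (π.measurable_queue_past H t)) hC]
  simp_rw [M.dual_eq_sum]
  rw [integral_finsetSum _ fun s _ =>
    (π.integrable_comp_queue hH t (M.continuous_stateDual V s)).const_mul _]
  simp_rw [integral_const_mul]

end Measurability

end NetworkModel.Policy

/-! ### Exponential drift towards the multiplier -/

/-- The exponential `exp (θ y)` cut off to `y ≥ D`. -/
noncomputable def expTail (θ D y : ℝ) : ℝ := if D ≤ y then Real.exp (θ * y) else 0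

lemma expTail_nonneg (θ D y : ℝ) : 0 ≤ expTail θ D y := by
  unfold expTail; split_ifs <;> positivity

lemma expTail_le (θ D y : ℝ) : expTail θ D y ≤ Real.exp (θ * y) := by
  unfold expTail; split_ifs
  · exact le_rfl
  · positivity

lemma measurable_expTail (θ D : ℝ) : Measurable (expTail θ D) :=
  Measurable.ite measurableSet_Ici (by fun_prop) measurable_const

/-- Negative drift of the square of a process with bounded increments gives negative drift of an
exponential of the process, up to the total increments near the origin. -/
lemma exp_mul_le_of_sq_le {θ D L B d F G y y' : ℝ} (hθ : 0 < θ) (hD : 0 < D)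
    (hd : |y' - y| ≤ d) (hF : |y' - y| ≤ F) (hθd : θ * d ≤ 1)
    (hθL : θ * d ^ 2 ≤ L / 4) (hB : B ≤ L * D) (hL : 0 < L) (hsq : y' ^ 2 ≤ y ^ 2 + 2 * G + B) :
    Real.exp (θ * y') ≤ Real.exp (θ * y) + θ * (expTail θ D y / y * G) +
      3 * L / 4 * θ * expTail θ D y + 2 * θ * Real.exp (θ * D) * F := by
  set z := θ * (y' - y) with hz
  have hzabs : |z| = θ * |y' - y| := by rw [hz, abs_mul, abs_of_pos hθ]
  have hz1 : |z| ≤ 1 := hzabs ▸ (mul_le_mul_of_nonneg_left hd hθ.le).trans hθd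
  have hexp : Real.exp z ≤ 1 + z + z ^ 2 := by
    have := (abs_le.1 (Real.abs_exp_sub_one_sub_id_le hz1)).2
    linarith
  have e : Real.exp (θ * y') = Real.exp (θ * y) * Real.exp z := by
    rw [← Real.exp_add]; congr 1; rw [hz]; ring
  have hF0 : 0 ≤ F := (abs_nonneg _).trans hF
  have hE := Real.exp_pos (θ * y)
  rw [e]
  by_cases h : D ≤ y
  · have hy0 : 0 < y := hD.trans_le h
    have ht : expTail θ D y = Real.exp (θ * y) := if_pos h
    -- Since `2y(y' - y) ≤ y'^2 - y^2 ≤ 2G + B` and `B ≤ L D ≤ L y`, dividing by `2y` turns drift of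
    -- the square into drift of `y`.
    have h1 : y' - y ≤ G / y + L / 2 := by
      have h2 : 2 * y * (y' - y) ≤ 2 * G + L * y := by
        nlinarith [sq_nonneg (y' - y), mul_le_mul_of_nonneg_left h hL.le]
      have e2 : G / y + L / 2 = (2 * G + L * y) / (2 * y) := by field_simp
      rw [e2, le_div_iff₀ (by positivity)]
      linarith
    -- The second-order term costs another `L/4`. With the `L/2` above this makes `3L/4`, which a
    -- mean of `G / y` of at most `-L` beats by `L/4`.
    have h3 : z ^ 2 ≤ θ * (L / 4) := by
      have : (y' - y) ^ 2 ≤ d ^ 2 := by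
        rw [← sq_abs]; exact pow_le_pow_left₀ (abs_nonneg _) hd 2
      calc z ^ 2 = θ * (θ * (y' - y) ^ 2) := by rw [hz]; ring
        _ ≤ θ * (θ * d ^ 2) := by gcongr
        _ ≤ θ * (L / 4) := by gcongr
    have h4 : Real.exp z ≤ 1 + θ * (G / y) + 3 * L / 4 * θ := by
      have := mul_le_mul_of_nonneg_left h1 hθ.le
      rw [← hz] at this
      linarith
    rw [ht]
    have h5 := mul_le_mul_of_nonneg_left h4 hE.le
    have h6 : 0 ≤ 2 * θ * Real.exp (θ * D) * F := by positivity
    calc _ ≤ _ := h5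
      _ = Real.exp (θ * y) + θ * (Real.exp (θ * y) / y * G) +
          3 * L / 4 * θ * Real.exp (θ * y) := by ring
      _ ≤ _ := by linarith
  -- Inside the radius there is no drift to use; the growth is bounded by the actual displacement
  -- `F`.
  · have ht : expTail θ D y = 0 := if_neg h
    push Not at h
    have h1 : Real.exp (θ * y) ≤ Real.exp (θ * D) := Real.exp_le_exp.2 (by nlinarith)
    have h2 : z ^ 2 ≤ |z| := by rw [← sq_abs]; nlinarith [abs_nonneg z]
    have h3 : |z| ≤ θ * F := hzabs ▸ mul_le_mul_of_nonneg_left hF hθ.le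
    have h4 : Real.exp z - 1 ≤ 2 * (θ * F) := by linarith [le_abs_self z]
    have h5 : Real.exp (θ * y) * (Real.exp z - 1) ≤ Real.exp (θ * D) * (2 * (θ * F)) :=
      (mul_le_mul_of_nonneg_left h4 hE.le).trans
        (mul_le_mul_of_nonneg_right h1 (by positivity))
    rw [ht]
    simp only [zero_div, zero_mul, mul_zero, add_zero]
    linarith

namespace NetworkModel.Policy

variable {r : ℕ} {σ : Type v} {α : Type w} [Fintype σ] [TopologicalSpace α]
  {M : NetworkModel r σ α} {Ω : Type u} [MeasurableSpace Ω] {P : Measure Ω}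
  [IsProbabilityMeasure P] (π : M.Policy P) {H : Fin r → ℝ}

lemma continuous_exp_euclNorm (θ : ℝ) (u : Fin r → ℝ) :
    Continuous fun w => Real.exp (θ * euclNorm (w - u)) :=
  Real.continuous_exp.comp
    (continuous_const.mul (continuous_euclNorm.comp (continuous_id.sub continuous_const)))

lemma measurable_expTail_euclNorm (θ D : ℝ) (u : Fin r → ℝ) :
    Measurable fun w => expTail θ D (euclNorm (w - u)) :=
  (measurable_expTail θ D).comp
    (continuous_euclNorm.comp (continuous_id.sub continuous_const)).measurable

lemma integrable_exp_euclNorm (hH : ∀ j, 0 ≤ H j) (θ : ℝ) (u : Fin r → ℝ) (t : ℕ) :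
    Integrable (fun ω => Real.exp (θ * euclNorm (π.queue H t ω - u))) P :=
  π.integrable_comp_queue hH t (continuous_exp_euclNorm θ u)

lemma integrable_expTail (hH : ∀ j, 0 ≤ H j) (θ D : ℝ) (u : Fin r → ℝ) (t : ℕ) :
    Integrable (fun ω => expTail θ D (euclNorm (π.queue H t ω - u))) P := by
  refine (π.integrable_exp_euclNorm hH θ u t).mono'
    ((measurable_expTail_euclNorm θ D u).comp (π.measurable_queue H t)).aestronglyMeasurable
    (Eventually.of_forall fun ω => ?_)
  rw [Real.norm_of_nonneg (expTail_nonneg _ _ _)]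
  exact expTail_le _ _ _

/-- The drift of QLA towards a polyhedral maximizer of the dual function, weighted by the
exponential tail. -/
lemma integral_expTail_drift_le (hH : ∀ j, 0 ≤ H j) {V L θ D : ℝ} {u : Fin r → ℝ} (hD : 0 < D)
    (hpol : ∀ U : Fin r → ℝ, (∀ j, 0 ≤ U j) →
      M.dual V U + L * euclNorm (U - u) ≤ M.dual V u) (t : ℕ) :
    Integrable (fun ω => expTail θ D (euclNorm (π.queue H t ω - u)) /
      euclNorm (π.queue H t ω - u) *
      (M.stateDual V (π.queue H t ω) (π.S t ω) - M.stateDual V u (π.S t ω))) P ∧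
    ∫ ω, expTail θ D (euclNorm (π.queue H t ω - u)) / euclNorm (π.queue H t ω - u) *
      (M.stateDual V (π.queue H t ω) (π.S t ω) - M.stateDual V u (π.S t ω)) ∂P ≤
    -L * ∫ ω, expTail θ D (euclNorm (π.queue H t ω - u)) ∂P := by
  set k : σ → (Fin r → ℝ) → ℝ := fun s w => expTail θ D (euclNorm (w - u)) / euclNorm (w - u) *
    (M.stateDual V w s - M.stateDual V u s) with hk
  have hnm : Measurable fun w : Fin r → ℝ => euclNorm (w - u) :=
    (continuous_euclNorm.comp (continuous_id.sub continuous_const)).measurable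
  have hkm : ∀ s, Measurable (k s) := fun s =>
    ((measurable_expTail_euclNorm θ D u).div hnm).mul
      ((M.continuous_stateDual V s).measurable.sub measurable_const)
  -- The Lipschitz bound on the state dual cancels the division by `y`, so the weighted drift is
  -- integrable.
  have hkb : ∀ s w, |k s w| ≤ r * M.δ * Real.exp (θ * euclNorm (w - u)) := by
    intro s w
    set y := euclNorm (w - u)
    have hy : 0 ≤ y := euclNorm_nonneg _
    have h1 : |M.stateDual V w s - M.stateDual V u s| ≤ r * M.δ * y := by
      have h2 := M.stateDual_le_add V w u s
      have h3 := M.stateDual_le_add V u w s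
      simp_rw [abs_sub_comm (u _)] at h3
      have h4 : ∑ j, |w j - u j| * M.δ ≤ r * M.δ * y := by
        calc ∑ j, |w j - u j| * M.δ ≤ ∑ _j : Fin r, y * M.δ :=
              Finset.sum_le_sum fun j _ =>
                mul_le_mul_of_nonneg_right (abs_le_euclNorm (w - u) j) M.δ_pos.le
          _ = r * M.δ * y := by simp; ring
      rw [abs_le]; constructor <;> linarith
    rw [hk, abs_mul, abs_div, abs_of_nonneg hy, abs_of_nonneg (expTail_nonneg _ _ _)]
    have hT := expTail_nonneg θ D y
    rcases hy.eq_or_lt with h0 | h0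
    -- At distance zero the quotient takes the default value `0`.
    · rw [← h0, div_zero, zero_mul]
      have := M.δ_pos
      positivity
    · calc expTail θ D y / y * |M.stateDual V w s - M.stateDual V u s|
          ≤ expTail θ D y / y * (r * M.δ * y) := by gcongr
        _ = r * M.δ * expTail θ D y := by field_simp
        _ ≤ _ := mul_le_mul_of_nonneg_left (expTail_le _ _ _)
          (mul_nonneg (Nat.cast_nonneg _) M.δ_pos.le)
  obtain ⟨C, hC⟩ := π.exists_bound_comp_queue hH t (continuous_exp_euclNorm θ u)
  have hkC : ∀ s ω, |k s (π.queue H t ω)| ≤ r * M.δ * C := fun s ω =>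
    (hkb s _).trans (mul_le_mul_of_nonneg_left ((le_abs_self _).trans (hC ω))
      (mul_nonneg (Nat.cast_nonneg _) M.δ_pos.le))
  have hki : ∀ s, Integrable (fun ω => k s (π.queue H t ω)) P := fun s =>
    integrable_of_abs_le ((hkm s).comp (π.measurable_queue H t)) (hkC s)
  refine ⟨integrable_of_abs_le (π.measurable_comp_S t (h := fun s ω => k s (π.queue H t ω))
    fun s => (hkm s).comp (π.measurable_queue H t)) fun ω => hkC _ ω, ?_⟩
  have h1 := π.integral_comp_S t (h := fun s ω => k s (π.queue H t ω))
    (fun s => (hkm s).comp (π.measurable_queue_past H t)) hkC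
  simp_rw [← integral_const_mul] at h1
  rw [← integral_finsetSum _ fun s _ => (hki s).const_mul _] at h1
  refine h1.le.trans ?_
  rw [← integral_const_mul]
  refine integral_mono (integrable_finsetSum _ fun s _ => (hki s).const_mul _)
    ((π.integrable_expTail hH θ D u t).const_mul _) fun ω => ?_
  set w := π.queue H t ω with hw
  -- Averaging over the independent state replaces state duals by the dual function, to which
  -- polyhedrality applies.
  have e : ∑ s, M.p s * k s w = expTail θ D (euclNorm (w - u)) / euclNorm (w - u) *
      (M.dual V w - M.dual V u) := by
    rw [M.dual_eq_sum, M.dual_eq_sum, ← Finset.sum_sub_distrib, Finset.mul_sum]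
    exact Finset.sum_congr rfl fun s _ => by rw [hk]; ring
  change ∑ s, M.p s * k s w ≤ -L * expTail θ D (euclNorm (w - u))
  rw [e]
  have h2 := hpol w fun j => π.queue_nonneg hH t ω j
  have hT := expTail_nonneg θ D (euclNorm (w - u))
  by_cases h : D ≤ euclNorm (w - u)
  · have hy0 := hD.trans_le h
    calc _ ≤ expTail θ D (euclNorm (w - u)) / euclNorm (w - u) * (-L * euclNorm (w - u)) := by
          gcongr; linarith
      _ = _ := by field_simp
  · simp [expTail, if_neg h]

/-- The summed exponential tail of the distance of the QLA backlog from a polyhedral maximizer of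
the dual function is bounded in terms of the expected total arrivals. -/
lemma sum_integral_expTail_le (hH : ∀ j, 0 ≤ H j) {V L θ D : ℝ} {u : Fin r → ℝ}
    (hu : ∀ j, 0 ≤ u j) (hQ : ∀ t ω, M.IsQLAAction V (π.queue H t ω) (π.S t ω) (π.x t ω))
    (hL : 0 < L) (hpol : ∀ U : Fin r → ℝ, (∀ j, 0 ≤ U j) →
      M.dual V U + L * euclNorm (U - u) ≤ M.dual V u)
    (hθ : 0 < θ) (hD : 0 < D) (hθd : θ * (r * M.δ) ≤ 1) (hθL : θ * (r * M.δ) ^ 2 ≤ L / 4)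
    (hDL : 3 * r * M.δ ^ 2 ≤ L * D) (t : ℕ) :
    θ * L / 4 * ∑ τ ∈ Finset.range t, ∫ ω, expTail θ D (euclNorm (π.queue H τ ω - u)) ∂P ≤
      Real.exp (θ * euclNorm (H - u)) + 2 * θ * Real.exp (θ * D) *
        (2 * ∑ τ ∈ Finset.range t, ∑ j, ∫ ω, π.A ω τ j ∂P + ∑ j, H j) := by
  set K := 2 * θ * Real.exp (θ * D) with hK
  have hK0 : 0 ≤ K := by positivity
  set E : ℕ → ℝ := fun τ => ∫ ω, Real.exp (θ * euclNorm (π.queue H τ ω - u)) ∂P with hE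
  set T : ℕ → ℝ := fun τ => ∫ ω, expTail θ D (euclNorm (π.queue H τ ω - u)) ∂P with hT
  set Z : ℕ → ℝ := fun τ => ∑ j, ∫ ω, π.queue H τ ω j ∂P with hZ
  have step : ∀ τ, E (τ + 1) ≤ E τ - θ * L / 4 * T τ +
      K * (2 * ∑ j, ∫ ω, π.A ω τ j ∂P - (Z (τ + 1) - Z τ)) := by
    intro τ
    obtain ⟨hi, hdrift⟩ := π.integral_expTail_drift_le (H := H) (θ := θ) hH hD hpol τ
    have hdiff : ∀ j, Integrable (fun ω => π.queue H (τ + 1) ω j - π.queue H τ ω j) P := fun j =>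
      (π.integrable_queue hH (τ + 1) j).sub (π.integrable_queue hH τ j)
    have hflow : ∀ j, Integrable (fun ω =>
        2 * π.A ω τ j - (π.queue H (τ + 1) ω j - π.queue H τ ω j)) P := fun j =>
      ((π.integrable_A τ j).const_mul 2).sub (hdiff j)
    have hflow' := integrable_finsetSum Finset.univ fun j _ => hflow j
    have hflow_eq : ∫ ω, ∑ j, (2 * π.A ω τ j - (π.queue H (τ + 1) ω j - π.queue H τ ω j)) ∂P =
        2 * ∑ j, ∫ ω, π.A ω τ j ∂P - (Z (τ + 1) - Z τ) := by
      rw [integral_finsetSum _ fun j _ => hflow j, hZ, Finset.mul_sum, ← Finset.sum_sub_distrib,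
        ← Finset.sum_sub_distrib]
      refine Finset.sum_congr rfl fun j _ => ?_
      rw [integral_sub ((π.integrable_A τ j).const_mul 2) (hdiff j),
        integral_sub (π.integrable_queue hH (τ + 1) j) (π.integrable_queue hH τ j),
        integral_const_mul]
    -- The pathwise drift has the Lagrangian at `u` of the chosen action; replacing it by its
    -- minimum over actions only weakens the bound and makes it a function of the state.
    have hpt : ∀ ω, Real.exp (θ * euclNorm (π.queue H (τ + 1) ω - u)) ≤
        Real.exp (θ * euclNorm (π.queue H τ ω - u)) +
        θ * (expTail θ D (euclNorm (π.queue H τ ω - u)) / euclNorm (π.queue H τ ω - u) *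
          (M.stateDual V (π.queue H τ ω) (π.S τ ω) - M.stateDual V u (π.S τ ω))) +
        3 * L / 4 * θ * expTail θ D (euclNorm (π.queue H τ ω - u)) +
        K * ∑ j, (2 * π.A ω τ j - (π.queue H (τ + 1) ω j - π.queue H τ ω j)) := by
      intro ω
      have hinc : |euclNorm (π.queue H (τ + 1) ω - u) - euclNorm (π.queue H τ ω - u)| ≤
          euclNorm (π.queue H (τ + 1) ω - π.queue H τ ω) := by
        simpa using abs_euclNorm_sub_le (π.queue H (τ + 1) ω - u) (π.queue H τ ω - u)
      refine exp_mul_le_of_sq_le hθ hD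
        (hinc.trans (π.euclNorm_queue_succ_sub_le hH τ ω))
        (hinc.trans ((euclNorm_le_sum_abs _).trans (Finset.sum_le_sum fun j _ =>
          π.abs_queue_succ_sub_le_flow hH τ ω j))) hθd hθL hDL hL ?_
      have h1 := π.sq_euclNorm_queue_succ_sub_le hH (hQ τ ω) hu
      have h2 := M.stateDual_le V u (π.x_mem τ ω)
      linarith
    have i1 := π.integrable_exp_euclNorm hH θ u τ
    have i3 := π.integrable_expTail hH θ D u τ
    have h1 := integral_mono (π.integrable_exp_euclNorm hH θ u (τ + 1))
      (((i1.add (hi.const_mul θ)).add (i3.const_mul (3 * L / 4 * θ))).add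
        (hflow'.const_mul K)) hpt
    rw [integral_add' ((i1.add (hi.const_mul θ)).add (i3.const_mul (3 * L / 4 * θ)))
        (hflow'.const_mul K), integral_add' (i1.add (hi.const_mul θ))
        (i3.const_mul (3 * L / 4 * θ)), integral_add' i1 (hi.const_mul θ), integral_const_mul,
        integral_const_mul, integral_const_mul, hflow_eq] at h1
    have h2 := mul_le_mul_of_nonneg_left hdrift hθ.le
    simp only [hE, hT]
    linarith
  -- The expected content `Z t` is kept so that the sum telescopes; it is then dropped by its sign.
  have sum : E t + θ * L / 4 * ∑ τ ∈ Finset.range t, T τ ≤ Real.exp (θ * euclNorm (H - u)) +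
      K * (2 * ∑ τ ∈ Finset.range t, ∑ j, ∫ ω, π.A ω τ j ∂P + ∑ j, H j - Z t) := by
    induction t with
    | zero => simp [hE, hZ, queue, backlog]
    | succ t ih =>
      rw [Finset.sum_range_succ, Finset.sum_range_succ]
      linarith [step t]
  have hE0 : 0 ≤ E t := integral_nonneg fun ω => (Real.exp_pos _).le
  have hZ0 : 0 ≤ Z t := Finset.sum_nonneg fun j _ => integral_nonneg fun ω =>
    π.queue_nonneg hH t ω j
  nlinarith [mul_nonneg hK0 hZ0]

end NetworkModel.Policy

/-! ### Limits superior of running averages -/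

section Limsup

lemma limsup_le_of_eventually_le_of_tendsto {u v : ℕ → ℝ} {c m : ℝ} (h : ∀ᶠ t in atTop, u t ≤ v t)
    (hv : Tendsto v atTop (𝓝 c)) (hm : ∀ t, m ≤ u t) : limsup u atTop ≤ c :=
  (limsup_le_limsup h (isBoundedUnder_of ⟨m, hm⟩ : IsBoundedUnder (· ≥ ·) atTop u).isCoboundedUnder_le
    hv.isBoundedUnder_le).trans_eq hv.limsup_eq

lemma tendsto_add_div_natCast (c k : ℝ) :
    Tendsto (fun t : ℕ => c + k / (t : ℝ)) atTop (𝓝 c) := by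
  simpa using (tendsto_const_div_atTop_nhds_zero_nat k).const_add c

lemma runningAvg_le_of_sum_le {a : ℕ → ℝ} {c k : ℝ}
    (h : ∀ t : ℕ, ∑ τ ∈ Finset.range t, a τ ≤ c * t + k) :
    ∀ᶠ t : ℕ in atTop, runningAvg a t ≤ c + k / (t : ℝ) := by
  filter_upwards [eventually_gt_atTop 0] with t ht
  have ht' : (0 : ℝ) < t := Nat.cast_pos.2 ht
  rw [runningAvg, div_le_iff₀ ht', add_mul, div_mul_cancel₀ _ ht'.ne']
  exact h t

lemma abs_runningAvg_le {a : ℕ → ℝ} {m : ℝ} (hm : 0 ≤ m) (h : ∀ t, |a t| ≤ m) (t : ℕ) :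
    |runningAvg a t| ≤ m := by
  rcases Nat.eq_zero_or_pos t with rfl | ht
  · simpa [runningAvg] using hm
  have ht' : (0 : ℝ) < t := Nat.cast_pos.2 ht
  rw [runningAvg, abs_div, abs_of_pos ht', div_le_iff₀ ht']
  calc |∑ τ ∈ Finset.range t, a τ| ≤ ∑ τ ∈ Finset.range t, |a τ| := Finset.abs_sum_le_sum_abs _ _
    _ ≤ ∑ _τ ∈ Finset.range t, m := Finset.sum_le_sum fun τ _ => h τ
    _ = m * t := by simp [mul_comm]

lemma limsup_runningAvg_le {a : ℕ → ℝ} {c k m : ℝ}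
    (h : ∀ t : ℕ, ∑ τ ∈ Finset.range t, a τ ≤ c * t + k) (hm : ∀ t, m ≤ runningAvg a t) :
    limsup (runningAvg a) atTop ≤ c :=
  limsup_le_of_eventually_le_of_tendsto (runningAvg_le_of_sum_le h) (tendsto_add_div_natCast c k) hm

lemma limsup_coe_runningAvg_le {a : ℕ → ℝ} {c k : ℝ}
    (h : ∀ t : ℕ, ∑ τ ∈ Finset.range t, a τ ≤ c * t + k) :
    limsup (fun t => ((runningAvg a t : ℝ) : EReal)) atTop ≤ ((c : ℝ) : EReal) := by
  have hv : Tendsto (fun t : ℕ => ((c + k / (t : ℝ) : ℝ) : EReal)) atTop (𝓝 ((c : ℝ) : EReal)) :=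
    (continuous_coe_real_ereal.tendsto c).comp (tendsto_add_div_natCast c k)
  refine (limsup_le_limsup ?_).trans_eq hv.limsup_eq
  filter_upwards [runningAvg_le_of_sum_le h] with t ht
  exact EReal.coe_le_coe_iff.2 ht

/-- A nonnegative sequence with finite limsup of averages is bounded infinitely often. -/
lemma exists_frequently_le_of_limsup_runningAvg_lt_top {z : ℕ → ℝ} (hz : ∀ t, 0 ≤ z t)
    (h : limsup (fun t => ((runningAvg z t : ℝ) : EReal)) atTop < ⊤) :
    ∃ N : ℝ, ∃ᶠ t in atTop, z t ≤ N := by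
  obtain ⟨N, hN, -⟩ := EReal.lt_iff_exists_real_btwn.1 h
  refine ⟨max N 0 + 1, fun hcon => ?_⟩
  set N' := max N 0 with hN'
  have hN0 : 0 ≤ N' := le_max_right _ _
  obtain ⟨T, hT⟩ := eventually_atTop.1 hcon
  obtain ⟨T', hT'⟩ := eventually_atTop.1 (eventually_lt_of_limsup_lt hN)
  -- If the sequence exceeded `N' + 1` from `T` on, then `(N' + 1)(t - T) ≤ N' t`, which fails for
  -- `t > (N' + 1) T`. The other terms put `t` beyond `T` and `T'`.
  obtain ⟨t, ht⟩ := exists_nat_ge ((N' + 1) * T + T + T' + 1)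
  have h1 : 0 ≤ (N' + 1) * T := by positivity
  have hTt : T ≤ t := by
    have : (T : ℝ) ≤ t := by linarith [(Nat.cast_nonneg T' : (0 : ℝ) ≤ T')]
    exact_mod_cast this
  have hTt' : T' ≤ t := by
    have : (T' : ℝ) ≤ t := by linarith [(Nat.cast_nonneg T : (0 : ℝ) ≤ T)]
    exact_mod_cast this
  have ht0 : (0 : ℝ) < t := by
    linarith [(Nat.cast_nonneg T' : (0 : ℝ) ≤ T'), (Nat.cast_nonneg T : (0 : ℝ) ≤ T)]
  have h2 : runningAvg z t < N := EReal.coe_lt_coe_iff.1 (hT' t hTt')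
  rw [runningAvg, div_lt_iff₀ ht0] at h2
  have h3 : (N' + 1) * ((t : ℝ) - T) ≤ ∑ τ ∈ Finset.range t, z τ := by
    calc (N' + 1) * ((t : ℝ) - T) = ∑ _τ ∈ Finset.Ico T t, (N' + 1) := by
          rw [Finset.sum_const, Nat.card_Ico, nsmul_eq_mul, Nat.cast_sub hTt, mul_comm]
      _ ≤ ∑ τ ∈ Finset.Ico T t, z τ := Finset.sum_le_sum fun τ hτ => by
          have := hT τ (Finset.mem_Ico.1 hτ).1
          linarith
      _ ≤ ∑ τ ∈ Finset.range t, z τ :=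
          Finset.sum_le_sum_of_subset_of_nonneg (fun τ hτ => by
            rw [Finset.mem_range]; exact (Finset.mem_Ico.1 hτ).2) fun τ _ _ => hz τ
  have h4 : N * t ≤ N' * t := mul_le_mul_of_nonneg_right (le_max_left _ _) ht0.le
  nlinarith [(Nat.cast_nonneg T' : (0 : ℝ) ≤ T'), (Nat.cast_nonneg T : (0 : ℝ) ≤ T)]

end Limsup

/-! ### Weak duality and drift plus penalty -/

namespace NetworkModel.Policy

variable {r : ℕ} {σ : Type v} {α : Type w} [Fintype σ] [TopologicalSpace α]
  {M : NetworkModel r σ α} {Ω : Type u} [MeasurableSpace Ω] {P : Measure Ω}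
  [IsProbabilityMeasure P] (π : M.Policy P) {H : Fin r → ℝ}

lemma integral_stateDual_const (V : ℝ) (u : Fin r → ℝ) (t : ℕ) :
    ∫ ω, M.stateDual V u (π.S t ω) ∂P = M.dual V u := by
  rw [π.integral_comp_S t (h := fun s _ => M.stateDual V u s) (fun s => measurable_const)
    (fun s _ => M.abs_stateDual_le V u s), M.dual_eq_sum]
  simp

lemma integrable_stateDual_const (V : ℝ) (u : Fin r → ℝ) (t : ℕ) :
    Integrable (fun ω => M.stateDual V u (π.S t ω)) P :=
  integrable_of_abs_le (π.measurable_comp_S t (h := fun s _ => M.stateDual V u s)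
    fun _ => measurable_const) fun _ => M.abs_stateDual_le V u _

/-- Weak duality along the trajectory of a policy. -/
lemma dual_mul_le_sum_cost_add {u : Fin r → ℝ} (hu : ∀ j, 0 ≤ u j) (t : ℕ) :
    M.dual 1 u * t ≤ ∑ τ ∈ Finset.range t, ∫ ω, π.cost τ ω ∂P +
      ∑ j, u j * ∫ ω, π.queue 0 t ω j ∂P := by
  have h0 : ∀ j, (0 : ℝ) ≤ (0 : Fin r → ℝ) j := fun _ => le_rfl
  induction t with
  | zero =>
    simp [queue, backlog]
  | succ t ih =>
    have hpt : ∀ ω, M.stateDual 1 u (π.S t ω) ≤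
        π.cost t ω + ∑ j, u j * (π.queue 0 (t + 1) ω j - π.queue 0 t ω j) := by
      intro ω
      refine (M.stateDual_le 1 u (π.x_mem t ω)).trans ?_
      unfold lagr
      rw [one_mul]
      refine add_le_add le_rfl (Finset.sum_le_sum fun j _ => mul_le_mul_of_nonneg_left ?_ (hu j))
      have := le_max_left (π.queue 0 t ω j - π.μ ω t j) 0
      rw [queue_succ]
      change π.A ω t j - π.μ ω t j ≤ _
      linarith
    have hdiff : ∀ j, Integrable (fun ω => π.queue 0 (t + 1) ω j - π.queue 0 t ω j) P := fun j =>
      (π.integrable_queue h0 (t + 1) j).sub (π.integrable_queue h0 t j)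
    have hs := integrable_finsetSum (μ := P) Finset.univ fun j _ => (hdiff j).const_mul (u j)
    have h1 := integral_mono (π.integrable_stateDual_const 1 u t) ((π.integrable_cost t).add hs) hpt
    rw [integral_stateDual_const, integral_add' (π.integrable_cost t) hs,
      integral_finsetSum _ fun j _ => (hdiff j).const_mul (u j)] at h1
    have h2 : ∑ j, ∫ ω, u j * (π.queue 0 (t + 1) ω j - π.queue 0 t ω j) ∂P =
        ∑ j, u j * ∫ ω, π.queue 0 (t + 1) ω j ∂P - ∑ j, u j * ∫ ω, π.queue 0 t ω j ∂P := by
      rw [← Finset.sum_sub_distrib]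
      refine Finset.sum_congr rfl fun j _ => ?_
      rw [integral_const_mul, integral_sub (π.integrable_queue h0 (t + 1) j)
        (π.integrable_queue h0 t j), mul_sub]
    rw [h2] at h1
    rw [Finset.sum_range_succ]
    push_cast
    linarith

/-- The average of a sequence that dominates the expected cost of a stable policy, up to an error
`c` per slot, is at least the dual value minus `c`. -/
lemma Stable.dual_sub_le_limsup {π : M.Policy P} (hπ : π.Stable) {u : Fin r → ℝ}
    (hu : ∀ j, 0 ≤ u j) {a : ℕ → ℝ} {c k m : ℝ} (hm : 0 ≤ m) (ha : ∀ t, |a t| ≤ m)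
    (h : ∀ t : ℕ, ∑ τ ∈ Finset.range t, ∫ ω, π.cost τ ω ∂P ≤
      ∑ τ ∈ Finset.range t, a τ + c * t + k) :
    M.dual 1 u - c ≤ limsup (runningAvg a) atTop := by
  have h0 : ∀ j, (0 : ℝ) ≤ (0 : Fin r → ℝ) j := fun _ => le_rfl
  have hz : ∀ t j, 0 ≤ ∫ ω, π.queue 0 t ω j ∂P := fun t j =>
    integral_nonneg fun ω => π.queue_nonneg h0 t ω j
  obtain ⟨N, hN⟩ := exists_frequently_le_of_limsup_runningAvg_lt_top
    (z := fun t => ∑ j, ∫ ω, π.queue 0 t ω j ∂P)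
    (fun t => Finset.sum_nonneg fun j _ => hz t j) hπ
  have hbdd : IsBoundedUnder (· ≤ ·) atTop (runningAvg a) :=
    isBoundedUnder_of ⟨m, fun t => (abs_le.1 (abs_runningAvg_le hm ha t)).2⟩
  refine le_of_forall_pos_le_add fun ε hε => ?_
  rw [← sub_le_iff_le_add]
  refine le_limsup_of_frequently_le ?_ hbdd
  set G := (∑ j, u j) * N + k with hG
  have hlim := (tendsto_add_div_natCast 0 G).eventually (gt_mem_nhds hε)
  -- Stability bounds the terminal backlog only infinitely often, which suffices for a lower bound
  -- on a limsup.
  refine (hN.and_eventually (hlim.and (eventually_gt_atTop 0))).mono fun t ⟨htN, htε, ht⟩ => ?_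
  have ht' : (0 : ℝ) < t := Nat.cast_pos.2 ht
  rw [zero_add, div_lt_iff₀ ht'] at htε
  rw [runningAvg, le_div_iff₀ ht']
  have h1 := π.dual_mul_le_sum_cost_add hu t
  have h2 : ∑ j, u j * ∫ ω, π.queue 0 t ω j ∂P ≤ (∑ j, u j) * N := by
    rw [Finset.sum_mul]
    refine Finset.sum_le_sum fun j _ => mul_le_mul_of_nonneg_left (le_trans ?_ htN) (hu j)
    exact Finset.single_le_sum (f := fun j => ∫ ω, π.queue 0 t ω j ∂P) (fun j _ => hz t j)
      (Finset.mem_univ j)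
  have h3 := h t
  linarith

lemma Stable.dual_le_avgCost {π : M.Policy P} (hπ : π.Stable) {u : Fin r → ℝ}
    (hu : ∀ j, 0 ≤ u j) : M.dual 1 u ≤ π.avgCost := by
  have := hπ.dual_sub_le_limsup hu (a := fun τ => ∫ ω, π.cost τ ω ∂P) (c := 0) (k := 0) M.δ_pos.le
    π.abs_integral_cost_le (fun t => by simp)
  simpa [avgCost] using this

/-- Drift plus penalty: the expected total cost of QLA. -/
lemma mul_sum_cost_le (hH : ∀ j, 0 ≤ H j) {V : ℝ} {u : Fin r → ℝ} (hu : M.IsDualOptimal V u)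
    (hQ : ∀ t ω, M.IsQLAAction V (π.queue H t ω) (π.S t ω) (π.x t ω)) (t : ℕ) :
    V * ∑ τ ∈ Finset.range t, ∫ ω, π.cost τ ω ∂P ≤
      (M.dual V u + 3 * r * M.δ ^ 2 / 2) * t + euclNorm H ^ 2 / 2 := by
  set Z : ℕ → ℝ := fun τ => ∫ ω, euclNorm (π.queue H τ ω) ^ 2 ∂P with hZ
  have hZi : ∀ τ, Integrable (fun ω => euclNorm (π.queue H τ ω) ^ 2) P := fun τ =>
    π.integrable_comp_queue hH τ (continuous_euclNorm.pow 2)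
  have step : ∀ τ, V * ∫ ω, π.cost τ ω ∂P ≤
      M.dual V u + 3 * r * M.δ ^ 2 / 2 + (Z τ - Z (τ + 1)) / 2 := by
    intro τ
    have hpt : ∀ ω, V * π.cost τ ω ≤ M.stateDual V (π.queue H τ ω) (π.S τ ω) +
        3 * r * M.δ ^ 2 / 2 +
        (euclNorm (π.queue H τ ω) ^ 2 - euclNorm (π.queue H (τ + 1) ω) ^ 2) / 2 := by
      intro ω
      -- Around the origin the Lagrangian is the bare penalty `V f`.
      have h1 := π.sq_euclNorm_queue_succ_sub_le hH (hQ τ ω) (u := 0) fun _ => le_rfl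
      have e : M.lagr V 0 (π.S τ ω) (π.x τ ω) = V * π.cost τ ω := by simp [lagr, cost]
      rw [sub_zero, sub_zero, e] at h1
      linarith
    have hdual : ∀ ω, M.dual V (π.queue H τ ω) ≤ M.dual V u := fun ω =>
      hu.2 _ fun j => π.queue_nonneg hH τ ω j
    have hc : Continuous fun w => M.dual V w := by
      simp_rw [M.dual_eq_sum]
      exact continuous_finsetSum _ fun s _ => continuous_const.mul (M.continuous_stateDual V s)
    have i0 := π.integrable_stateDual H hH V τ
    have i1 : Integrable (fun _ : Ω => 3 * r * M.δ ^ 2 / 2) P := integrable_const _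
    have i2 : Integrable (fun ω =>
      (euclNorm (π.queue H τ ω) ^ 2 - euclNorm (π.queue H (τ + 1) ω) ^ 2) / 2) P :=
      ((hZi τ).sub (hZi (τ + 1))).div_const 2
    have h1 := integral_mono ((π.integrable_cost τ).const_mul V) ((i0.add i1).add i2) hpt
    have h2 : ∫ ω, M.dual V (π.queue H τ ω) ∂P ≤ M.dual V u := by
      refine (integral_mono (π.integrable_comp_queue hH τ hc)
        (integrable_const (M.dual V u)) hdual).trans_eq (by simp)
    rw [integral_const_mul, integral_add' (i0.add i1) i2, integral_add' i0 i1,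
      π.integral_stateDual H hH, integral_const, integral_div,
      integral_sub (hZi τ) (hZi (τ + 1))] at h1
    simp only [probReal_univ, one_smul] at h1
    simp only [hZ]
    linarith
  have sum : V * ∑ τ ∈ Finset.range t, ∫ ω, π.cost τ ω ∂P ≤
      (M.dual V u + 3 * r * M.δ ^ 2 / 2) * t + (euclNorm H ^ 2 - Z t) / 2 := by
    induction t with
    | zero => simp [hZ, queue, backlog]
    | succ t ih =>
      rw [Finset.sum_range_succ]
      push_cast
      linarith [step t]
  have : 0 ≤ Z t := integral_nonneg fun ω => sq_nonneg _
  linarith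

/-- Expected backlogs that stay within a distance of the multiplier are controlled by the
exponential tail. -/
lemma sum_integral_le_of_le_add_euclNorm (hH : ∀ j, 0 ≤ H j) {θ : ℝ} (hθ : 0 < θ) (D : ℝ)
    (u : Fin r → ℝ) {F : Ω → Fin r → ℝ} {c : Fin r → ℝ} (t : ℕ) (hF : ∀ ω j, 0 ≤ F ω j)
    (h : ∀ ω j, F ω j ≤ c j + euclNorm (π.queue H t ω - u)) :
    ∑ j, ∫ ω, F ω j ∂P ≤ ∑ j, (c j + Real.exp (θ * D) / θ) +
      r / θ * ∫ ω, expTail θ D (euclNorm (π.queue H t ω - u)) ∂P := by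
  -- `θ y ≤ exp (θ y)`, with the exponential split at `D` into a constant and the tail.
  have hexp : ∀ y : ℝ, y ≤ Real.exp (θ * D) / θ + 1 / θ * expTail θ D y := by
    intro y
    have h1 : θ * y ≤ Real.exp (θ * y) := by linarith [Real.add_one_le_exp (θ * y)]
    have h2 : Real.exp (θ * y) ≤ Real.exp (θ * D) + expTail θ D y := by
      unfold expTail
      split_ifs with hy
      · linarith [Real.exp_pos (θ * D)]
      · push Not at hy
        rw [add_zero]
        exact Real.exp_le_exp.2 (mul_le_mul_of_nonneg_left hy.le hθ.le)
    have e : Real.exp (θ * D) / θ + 1 / θ * expTail θ D y =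
        (Real.exp (θ * D) + expTail θ D y) / θ := by ring
    rw [e, le_div_iff₀ hθ]
    linarith
  have i := (π.integrable_expTail hH θ D u t).const_mul (1 / θ)
  have h1 : ∀ j, ∫ ω, F ω j ∂P ≤ c j + Real.exp (θ * D) / θ +
      1 / θ * ∫ ω, expTail θ D (euclNorm (π.queue H t ω - u)) ∂P := by
    intro j
    have ic : Integrable (fun _ : Ω => c j + Real.exp (θ * D) / θ) P := integrable_const _
    have h2 := integral_mono_of_nonneg (μ := P) (f := fun ω => F ω j)
      (Eventually.of_forall fun ω => hF ω j) (ic.add i) (Eventually.of_forall fun ω => by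
        have := hexp (euclNorm (π.queue H t ω - u))
        have := h ω j
        simp only [Pi.add_apply]
        linarith)
    rw [integral_add' ic i, integral_const, integral_const_mul] at h2
    simpa using h2
  refine (Finset.sum_le_sum fun j _ => h1 j).trans_eq ?_
  rw [Finset.sum_add_distrib]
  simp
  ring

end NetworkModel.Policy

/-! ### FQLA-Ideal: backlog, drops and cost -/

lemma admitted_nonneg {r : ℕ} {H W A : Fin r → ℝ} {j : Fin r} (hA : 0 ≤ A j) :
    0 ≤ admitted H W A j := by
  unfold admitted
  split_ifs
  · exact hA
  · exact le_max_right _ _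

lemma admitted_le {r : ℕ} {H W A : Fin r → ℝ} {j : Fin r} (hA : 0 ≤ A j) :
    admitted H W A j ≤ A j := by
  unfold admitted
  split_ifs
  · exact le_rfl
  · exact max_le (by linarith) hA

lemma placeholder_nonneg {r : ℕ} (V : ℝ) (UV : Fin r → ℝ) (j : Fin r) : 0 ≤ placeholder V UV j :=
  le_max_right _ _

/-- The actual backlog exceeds the virtual backlog above the place-holder level by at most one
slot of arrivals. -/
lemma backlog_admitted_le {r : ℕ} {δ : ℝ} {H : Fin r → ℝ} {A m : ℕ → Fin r → ℝ}
    (hA : ∀ t j, 0 ≤ A t j) (hAδ : ∀ t j, A t j ≤ δ)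
    (hm : ∀ t j, 0 ≤ m t j) (j : Fin r) (t : ℕ) :
    backlog 0 (fun t => admitted H (backlog H A m t) (A t)) m t j ≤
      max (backlog H A m t j - H j) 0 + δ := by
  induction t with
  | zero =>
    have := (hA 0 j).trans (hAδ 0 j)
    simpa [backlog] using this
  | succ t ih =>
    set x := backlog 0 (fun t => admitted H (backlog H A m t) (A t)) m t j
    set w := backlog H A m t j with hw
    have h0 := hA t j
    have hδ := hAδ t j
    have hW : w - m t j + A t j ≤ backlog H A m (t + 1) j := by
      have := le_max_left (w - m t j) 0
      change _ ≤ max (w - m t j) 0 + A t j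
      linarith
    set w' := backlog H A m (t + 1) j with hw'
    change max (x - m t j) 0 + admitted H (backlog H A m t) (A t) j ≤ _
    have hp := le_max_left (w' - H j) 0
    have hp0 := le_max_right (w' - H j) 0
    unfold admitted
    rw [← hw]
    split_ifs with h
    · rw [max_eq_left (sub_nonneg.2 h)] at ih
      rcases le_total (x - m t j) 0 with hx | hx
      · rw [max_eq_right hx]; linarith
      · rw [max_eq_left hx]; linarith
    -- Below the place-holder level the real backlog is at most `δ`. If service empties it, only the
    -- admitted packets remain; otherwise it moves no higher than `W - H` allows.
    · push Not at h
      rw [max_eq_right (by linarith)] at ih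
      rcases le_total (x - m t j) 0 with hx | hx
      · rw [max_eq_right hx]
        have : max (A t j - H j + w) 0 ≤ δ := max_le (by linarith) (by linarith)
        linarith
      · rw [max_eq_left hx]
        rcases le_total (A t j - H j + w) 0 with ha | ha
        · rw [max_eq_right ha]
          linarith [hm t j]
        · rw [max_eq_left ha]; linarith

namespace NetworkModel.FQLAIdeal

variable {r : ℕ} {σ : Type v} {α : Type w} [Fintype σ] [TopologicalSpace α]
  {M : NetworkModel r σ α} {V : ℝ} {UV : Fin r → ℝ} {Ω : Type u} [MeasurableSpace Ω]
  {P : Measure Ω} (R : M.FQLAIdeal V UV P)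

lemma W_nonneg (ω : Ω) (t : ℕ) (j : Fin r) : 0 ≤ R.W ω t j :=
  R.queue_nonneg (placeholder_nonneg V UV) t ω j

lemma U_nonneg (ω : Ω) (t : ℕ) (j : Fin r) : 0 ≤ R.U ω t j := by
  cases t with
  | zero => exact le_rfl
  | succ t => exact add_nonneg (le_max_right _ _) (admitted_nonneg (R.A_nonneg ω t j))

lemma W_le (ω : Ω) (t : ℕ) (j : Fin r) : R.W ω t j ≤ UV j + euclNorm (R.W ω t - UV) := by
  have := (le_abs_self _).trans (abs_le_euclNorm (R.W ω t - UV) j)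
  rw [Pi.sub_apply] at this
  linarith

lemma U_le (ω : Ω) (t : ℕ) (j : Fin r) :
    R.U ω t j ≤ (Real.log V ^ 2 + M.δ) + euclNorm (R.W ω t - UV) := by
  have h1 : R.U ω t j ≤ max (R.W ω t j - placeholder V UV j) 0 + M.δ :=
    backlog_admitted_le (R.A_nonneg ω) (R.A_le ω) (R.μ_nonneg ω) j t
  have h2 := R.W_le ω t j
  have h3 : UV j - Real.log V ^ 2 ≤ placeholder V UV j := le_max_left _ _
  have h4 : max (R.W ω t j - placeholder V UV j) 0 ≤
      Real.log V ^ 2 + euclNorm (R.W ω t - UV) :=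
    max_le (by linarith) (add_nonneg (sq_nonneg _) (euclNorm_nonneg _))
  linarith

/-- Below the place-holder level, the exponential tail is large. -/
lemma one_le_exp_mul_expTail {θ D : ℝ} (hθ : 0 < θ) (hD : D ≤ Real.log V ^ 2) {ω : Ω} {t : ℕ}
    {j : Fin r} (h : R.W ω t j < placeholder V UV j) :
    1 ≤ Real.exp (-(θ * Real.log V ^ 2)) * expTail θ D (euclNorm (R.W ω t - UV)) := by
  have h0 := R.W_nonneg ω t j
  -- A nonnegative `W` can lie below the level only if the level is positive, so the truncation at
  -- `0` is inactive.
  have h1 : placeholder V UV j = UV j - Real.log V ^ 2 := by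
    unfold placeholder at h ⊢
    rcases le_total (UV j - Real.log V ^ 2) 0 with h2 | h2
    · rw [max_eq_right h2] at h; linarith
    · exact max_eq_left h2
  have h2 : Real.log V ^ 2 ≤ euclNorm (R.W ω t - UV) := by
    have := (neg_le_abs _).trans (abs_le_euclNorm (R.W ω t - UV) j)
    rw [Pi.sub_apply] at this
    linarith
  rw [expTail, if_pos (hD.trans h2), ← Real.exp_add]
  refine Real.one_le_exp ?_
  nlinarith

lemma drop_nonneg (ω : Ω) (t : ℕ) (j : Fin r) : 0 ≤ R.A ω t j - R.adm ω t j :=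
  sub_nonneg.2 (admitted_le (R.A_nonneg ω t j))

lemma drop_le {θ D : ℝ} (hθ : 0 < θ) (hD : D ≤ Real.log V ^ 2) (ω : Ω) (t : ℕ) (j : Fin r) :
    R.A ω t j - R.adm ω t j ≤ M.δ * Real.exp (-(θ * Real.log V ^ 2)) *
      expTail θ D (euclNorm (R.W ω t - UV)) := by
  by_cases h : placeholder V UV j ≤ R.W ω t j
  · rw [adm, admitted, if_pos h, sub_self]
    exact mul_nonneg (mul_nonneg M.δ_pos.le (Real.exp_pos _).le) (expTail_nonneg _ _ _)
  · have h1 := R.one_le_exp_mul_expTail hθ hD (not_le.1 h)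
    have h2 : 0 ≤ R.adm ω t j := admitted_nonneg (R.A_nonneg ω t j)
    have h3 := R.A_le ω t j
    rw [mul_assoc]
    nlinarith [mul_le_mul_of_nonneg_left h1 M.δ_pos.le]

lemma abs_incurred_sub_cost_le {θ D : ℝ} (hθ : 0 < θ) (hD : D ≤ Real.log V ^ 2) (ω : Ω) (t : ℕ) :
    |R.incurred t ω - R.cost t ω| ≤ 2 * M.δ * Real.exp (-(θ * Real.log V ^ 2)) *
      expTail θ D (euclNorm (R.W ω t - UV)) := by
  by_cases h : ∀ j, placeholder V UV j ≤ R.W ω t j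
  · rw [R.incurred_eq t ω h, sub_self, abs_zero]
    have := M.δ_pos
    have := expTail_nonneg θ D (euclNorm (R.W ω t - UV))
    positivity
  · push Not at h
    obtain ⟨j, hj⟩ := h
    have h1 := R.one_le_exp_mul_expTail hθ hD hj
    have h2 := abs_sub (R.incurred t ω) (R.cost t ω)
    have h3 := R.incurred_bound t ω
    have h4 := R.abs_cost_le t ω
    rw [mul_assoc]
    nlinarith [mul_le_mul_of_nonneg_left h1 M.δ_pos.le]

lemma dropped_nonneg (t : ℕ) : 0 ≤ R.dropped t :=
  Finset.sum_nonneg fun j _ => integral_nonneg fun ω => R.drop_nonneg ω t j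

lemma arrived_nonneg (t : ℕ) : 0 ≤ R.arrived t :=
  Finset.sum_nonneg fun j _ => integral_nonneg fun ω => R.A_nonneg ω t j

variable [IsProbabilityMeasure P]

/-- The expected exponential tail of the distance of the virtual backlog from the multiplier. -/
noncomputable def tail (θ D : ℝ) (t : ℕ) : ℝ :=
  ∫ ω, expTail θ D (euclNorm (R.W ω t - UV)) ∂P

lemma integrable_tail (θ D : ℝ) (t : ℕ) :
    Integrable (fun ω => expTail θ D (euclNorm (R.W ω t - UV))) P :=
  R.integrable_expTail (placeholder_nonneg V UV) θ D UV t

lemma arrived_le (t : ℕ) : R.arrived t ≤ r * M.δ := by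
  calc R.arrived t ≤ ∑ _j : Fin r, M.δ := Finset.sum_le_sum fun j _ => by
        refine (integral_mono (R.integrable_A t j) (integrable_const M.δ)
          fun ω => R.A_le ω t j).trans_eq (by simp)
    _ = r * M.δ := by simp

lemma dropped_le {θ D : ℝ} (hθ : 0 < θ) (hD : D ≤ Real.log V ^ 2) (t : ℕ) :
    R.dropped t ≤ r * M.δ * Real.exp (-(θ * Real.log V ^ 2)) * R.tail θ D t := by
  calc R.dropped t ≤ ∑ _j : Fin r, M.δ * Real.exp (-(θ * Real.log V ^ 2)) * R.tail θ D t :=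
        Finset.sum_le_sum fun j _ => by
          rw [tail, ← integral_const_mul]
          exact integral_mono_of_nonneg (Eventually.of_forall fun ω => R.drop_nonneg ω t j)
            ((R.integrable_tail θ D t).const_mul _)
            (Eventually.of_forall fun ω => R.drop_le hθ hD ω t j)
    _ = _ := by simp; ring

lemma integrable_incurred (t : ℕ) : Integrable (R.incurred t) P :=
  integrable_of_abs_le (R.incurred_meas t) (R.incurred_bound t)

lemma abs_integral_incurred_le (t : ℕ) : |∫ ω, R.incurred t ω ∂P| ≤ M.δ := by
  simpa using norm_integral_le_of_norm_le_const (μ := P) (f := R.incurred t)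
    (Eventually.of_forall (R.incurred_bound t))

lemma abs_integral_incurred_sub_le {θ D : ℝ} (hθ : 0 < θ) (hD : D ≤ Real.log V ^ 2) (t : ℕ) :
    |∫ ω, R.incurred t ω ∂P - ∫ ω, R.cost t ω ∂P| ≤
      2 * M.δ * Real.exp (-(θ * Real.log V ^ 2)) * R.tail θ D t := by
  rw [← integral_sub (R.integrable_incurred t) (R.integrable_cost t), tail, ← integral_const_mul]
  exact norm_integral_le_of_norm_le (f := fun ω => R.incurred t ω - R.cost t ω)
    ((R.integrable_tail θ D t).const_mul _)
    (Eventually.of_forall fun ω => R.abs_incurred_sub_cost_le hθ hD ω t)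

/-- The bound on the summed tail that all estimates rest on. -/
lemma sum_tail_le {L θ D : ℝ} (hUV : M.IsDualOptimal V UV) (hL : 0 < L)
    (hpol : ∀ U : Fin r → ℝ, (∀ j, 0 ≤ U j) →
      M.dual V U + L * euclNorm (U - UV) ≤ M.dual V UV)
    (hθ : 0 < θ) (hD : 0 < D) (hθd : θ * (r * M.δ) ≤ 1) (hθL : θ * (r * M.δ) ^ 2 ≤ L / 4)
    (hDL : 3 * r * M.δ ^ 2 ≤ L * D) :
    ∃ k, ∀ t : ℕ, ∑ τ ∈ Finset.range t, R.tail θ D τ ≤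
      16 * Real.exp (θ * D) / L * ∑ τ ∈ Finset.range t, R.arrived τ + k := by
  refine ⟨(Real.exp (θ * euclNorm (placeholder V UV - UV)) + 2 * θ * Real.exp (θ * D) *
    ∑ j, placeholder V UV j) / (θ * L / 4), fun t => ?_⟩
  have h := R.sum_integral_expTail_le (placeholder_nonneg V UV) hUV.1 R.isQLA hL hpol hθ hD hθd
    hθL hDL t
  have hpos : 0 < θ * L / 4 := by positivity
  have e : 16 * Real.exp (θ * D) / L * ∑ τ ∈ Finset.range t, R.arrived τ =
      (2 * θ * Real.exp (θ * D) * (2 * ∑ τ ∈ Finset.range t, R.arrived τ)) / (θ * L / 4) := by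
    field_simp
    ring
  rw [e, ← add_div, le_div_iff₀ hpos, mul_comm]
  refine h.trans_eq ?_
  simp only [arrived]
  ring

/-- Stability is judged from empty queues, while the actions are driven by `W`, which starts at the
place-holder level. Under the same arrivals and services, monotonicity in the initial backlog
compares the two. -/
lemma stable {θ D c k : ℝ} (hθ : 0 < θ)
    (h : ∀ t : ℕ, ∑ τ ∈ Finset.range t, R.tail θ D τ ≤ c * t + k) : R.toPolicy.Stable := by
  have hz : ∀ t, ∑ j, ∫ ω, backlog 0 (R.A ω) (R.μ ω) t j ∂P ≤
      ∑ j, (UV j + Real.exp (θ * D) / θ) + r / θ * R.tail θ D t := fun t =>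
    R.sum_integral_le_of_le_add_euclNorm (placeholder_nonneg V UV) hθ D UV
      (F := fun ω j => backlog 0 (R.A ω) (R.μ ω) t j) t
      (fun ω j => R.queue_nonneg (H := 0) (fun _ => le_rfl) t ω j)
      (fun ω j => (backlog_mono (placeholder_nonneg V UV) _ _ t j).trans (R.W_le ω t j))
  refine lt_of_le_of_lt (limsup_coe_runningAvg_le
    (c := ∑ j, (UV j + Real.exp (θ * D) / θ) + r / θ * c) (k := r / θ * k) fun t => ?_)
    (EReal.coe_lt_top _)
  refine (Finset.sum_le_sum fun τ _ => hz τ).trans ?_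
  rw [Finset.sum_add_distrib, ← Finset.mul_sum, Finset.sum_const, Finset.card_range, nsmul_eq_mul]
  have := mul_le_mul_of_nonneg_left (h t) (by positivity : (0 : ℝ) ≤ r / θ)
  linarith

lemma avgBacklog_le {θ D c k : ℝ} (hθ : 0 < θ)
    (h : ∀ t : ℕ, ∑ τ ∈ Finset.range t, R.tail θ D τ ≤ c * t + k) :
    R.avgBacklog ≤ ((r * (Real.log V ^ 2 + M.δ + Real.exp (θ * D) / θ) + r / θ * c : ℝ) :
      EReal) := by
  have hz : ∀ t, ∑ j, ∫ ω, R.U ω t j ∂P ≤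
      ∑ _j : Fin r, (Real.log V ^ 2 + M.δ + Real.exp (θ * D) / θ) + r / θ * R.tail θ D t := fun t =>
    R.sum_integral_le_of_le_add_euclNorm (placeholder_nonneg V UV) hθ D UV
      (F := fun ω => R.U ω t) (c := fun _ => Real.log V ^ 2 + M.δ) t
      (fun ω j => R.U_nonneg ω t j) (fun ω j => R.U_le ω t j)
  refine limsup_coe_runningAvg_le (k := r / θ * k) fun t => ?_
  refine (Finset.sum_le_sum fun τ _ => hz τ).trans ?_
  rw [Finset.sum_add_distrib, ← Finset.mul_sum, Finset.sum_const, Finset.sum_const,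
    Finset.card_range, Finset.card_univ, Fintype.card_fin, nsmul_eq_mul, nsmul_eq_mul]
  have := mul_le_mul_of_nonneg_left (h t) (by positivity : (0 : ℝ) ≤ r / θ)
  linarith

lemma dropRate_le {θ D c k : ℝ} (hθ : 0 < θ) (hD : D ≤ Real.log V ^ 2)
    (h : ∀ t : ℕ, ∑ τ ∈ Finset.range t, R.tail θ D τ ≤ c * t + k) :
    R.dropRate ≤ r * M.δ * c * Real.exp (-(θ * Real.log V ^ 2)) := by
  have hδ := M.δ_pos
  refine limsup_runningAvg_le (k := r * M.δ * Real.exp (-(θ * Real.log V ^ 2)) * k) (m := 0)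
    (fun t => ?_) fun t =>
      div_nonneg (Finset.sum_nonneg fun τ _ => R.dropped_nonneg τ) (Nat.cast_nonneg _)
  refine (Finset.sum_le_sum fun τ _ => R.dropped_le hθ hD τ).trans ?_
  rw [← Finset.mul_sum]
  have := mul_le_mul_of_nonneg_left (h t)
    (by positivity : 0 ≤ r * M.δ * Real.exp (-(θ * Real.log V ^ 2)))
  linarith

/-- Here the tail has to be bounded by arrivals, not by slots, for the ratio to be controlled when
arrivals are sparse. -/
lemma dropFraction_le {θ D c k : ℝ} (hθ : 0 < θ) (hD : D ≤ Real.log V ^ 2)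
    (h : ∀ t : ℕ, ∑ τ ∈ Finset.range t, R.tail θ D τ ≤
      c * ∑ τ ∈ Finset.range t, R.arrived τ + k)
    (ha : Tendsto (fun t : ℕ => ∑ τ ∈ Finset.range t, R.arrived τ) atTop atTop) :
    R.dropFraction ≤ r * M.δ * c * Real.exp (-(θ * Real.log V ^ 2)) := by
  have hδ := M.δ_pos
  set B := r * M.δ * Real.exp (-(θ * Real.log V ^ 2)) with hB
  have hB0 : 0 ≤ B := by positivity
  have hv : Tendsto (fun t : ℕ => B * c + B * k / ∑ τ ∈ Finset.range t, R.arrived τ) atTop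
      (𝓝 (r * M.δ * c * Real.exp (-(θ * Real.log V ^ 2)))) := by
    have := (ha.const_div_atTop (B * k)).const_add (B * c)
    rw [add_zero] at this
    convert this using 2
    rw [hB]; ring
  refine limsup_le_of_eventually_le_of_tendsto (m := 0) ?_ hv fun t =>
    div_nonneg (Finset.sum_nonneg fun τ _ => R.dropped_nonneg τ)
      (Finset.sum_nonneg fun τ _ => R.arrived_nonneg τ)
  filter_upwards [ha.eventually_gt_atTop 0] with t ht
  rw [div_le_iff₀ ht, add_mul, div_mul_cancel₀ _ ht.ne']
  refine (Finset.sum_le_sum fun τ _ => R.dropped_le hθ hD τ).trans ?_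
  rw [← Finset.mul_sum]
  have := mul_le_mul_of_nonneg_left (h t) hB0
  linarith

lemma bddBelow_avgCost (M : NetworkModel r σ α) :
    BddBelow {c : ℝ | ∃ (Ω : Type u) (_ : MeasurableSpace Ω) (P : Measure Ω)
      (_ : IsProbabilityMeasure P) (π : M.Policy P), π.Stable ∧ c = π.avgCost} := by
  refine ⟨M.dual 1 0, ?_⟩
  rintro _ ⟨Ω, _, P, _, π, hπ, rfl⟩
  exact hπ.dual_le_avgCost fun _ => le_rfl

/-- Both quantities lie near `q_0(U*_0)`: the optimum is at least this by weak duality and at most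
the QLA cost, as the run is itself a stable policy. The incurred cost differs from the QLA cost only
in slots charged to the tail. -/
lemma abs_avgIncurred_sub_optCost_le {U₀ : Fin r → ℝ} (hU₀ : ∀ j, 0 ≤ U₀ j) (hV : 0 < V)
    (hUV : M.IsDualOptimal V UV) (hdual : M.dual V UV = V * M.dual 1 U₀)
    {θ D c k : ℝ} (hθ : 0 < θ) (hD : D ≤ Real.log V ^ 2)
    (h : ∀ t : ℕ, ∑ τ ∈ Finset.range t, R.tail θ D τ ≤ c * t + k) :
    |R.avgIncurred - NetworkModel.optCost.{u} M| ≤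
      3 * r * M.δ ^ 2 / 2 / V + 2 * M.δ * Real.exp (-(θ * Real.log V ^ 2)) * c := by
  have hδ := M.δ_pos
  set B := 2 * M.δ * Real.exp (-(θ * Real.log V ^ 2)) with hB
  have hB0 : 0 ≤ B := by positivity
  have hst := R.stable hθ h
  have hdiff : ∀ t : ℕ, |∑ τ ∈ Finset.range t, ∫ ω, R.incurred τ ω ∂P -
      ∑ τ ∈ Finset.range t, ∫ ω, R.cost τ ω ∂P| ≤ B * c * t + B * k := by
    intro t
    rw [← Finset.sum_sub_distrib]
    refine (Finset.abs_sum_le_sum_abs _ _).trans ?_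
    refine (Finset.sum_le_sum fun τ _ => R.abs_integral_incurred_sub_le hθ hD τ).trans ?_
    rw [← Finset.mul_sum]
    have := mul_le_mul_of_nonneg_left (h t) hB0
    linarith
  have hcost : ∀ t : ℕ, ∑ τ ∈ Finset.range t, ∫ ω, R.cost τ ω ∂P ≤
      (M.dual 1 U₀ + 3 * r * M.δ ^ 2 / 2 / V) * t +
        euclNorm (placeholder V UV) ^ 2 / 2 / V := by
    intro t
    have h1 := R.mul_sum_cost_le (placeholder_nonneg V UV) hUV R.isQLA t
    rw [hdual] at h1
    rw [← mul_le_mul_iff_right₀ hV]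
    refine h1.trans_eq ?_
    field_simp
  have hopt_ge : M.dual 1 U₀ ≤ NetworkModel.optCost.{u} M := by
    refine le_csInf ⟨_, Ω, _, P, inferInstance, R.toPolicy, hst, rfl⟩ ?_
    rintro _ ⟨Ω', _, P', _, π, hπ, rfl⟩
    exact hπ.dual_le_avgCost hU₀
  have hopt_le : NetworkModel.optCost.{u} M ≤ R.avgCost :=
    csInf_le (bddBelow_avgCost M) ⟨Ω, _, P, inferInstance, R.toPolicy, hst, rfl⟩
  have hcost_le : R.avgCost ≤ M.dual 1 U₀ + 3 * r * M.δ ^ 2 / 2 / V :=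
    limsup_runningAvg_le hcost fun t =>
      (abs_le.1 (abs_runningAvg_le hδ.le R.abs_integral_cost_le t)).1
  have hinc_ge : M.dual 1 U₀ - B * c ≤ R.avgIncurred :=
    hst.dual_sub_le_limsup hU₀ (k := B * k) hδ.le R.abs_integral_incurred_le fun t => by
      linarith [(abs_le.1 (hdiff t)).1]
  have hinc_le : R.avgIncurred ≤ M.dual 1 U₀ + 3 * r * M.δ ^ 2 / 2 / V + B * c :=
    limsup_runningAvg_le (k := B * k + euclNorm (placeholder V UV) ^ 2 / 2 / V)
      (fun t => by linarith [(abs_le.1 (hdiff t)).2, hcost t]) fun t =>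
      (abs_le.1 (abs_runningAvg_le hδ.le R.abs_integral_incurred_le t)).1
  rw [abs_le]
  constructor <;> linarith

end NetworkModel.FQLAIdeal

theorem theorem5 {r : ℕ} (hr : 1 ≤ r) {σ : Type v} {α : Type w} [Fintype σ] [TopologicalSpace α]
    (M : NetworkModel r σ α) (U₀ : Fin r → ℝ) (hU₀ : M.IsDualOptimal 1 U₀)
    (hpoly : M.LocallyPolyhedral U₀) :
    ∃ c₀ C V₀ : ℝ, 0 < c₀ ∧ 1 ≤ V₀ ∧
      ∀ V : ℝ, V₀ ≤ V → ∀ UV : Fin r → ℝ, M.IsDualOptimal V UV →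
      ∀ (Ω : Type u) [MeasurableSpace Ω] (P : Measure Ω) [IsProbabilityMeasure P]
        (R : M.FQLAIdeal V UV P),
        R.avgBacklog ≤ ((C * Real.log V ^ 2 : ℝ) : EReal) ∧
        |R.avgIncurred - NetworkModel.optCost.{u} M| ≤ C / V ∧
        R.dropRate ≤ C / V ^ (c₀ * Real.log V) ∧
        (Tendsto (fun t : ℕ => ∑ τ ∈ Finset.range t, R.arrived τ) atTop atTop →
          R.dropFraction ≤ C / V ^ (c₀ * Real.log V)) := by
  obtain ⟨L, hL, hpol⟩ := hpoly.global hU₀.1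
  have hδ := M.δ_pos
  have hr0 : (0 : ℝ) < r := by exact_mod_cast hr
  have hd : 0 < r * M.δ := by positivity
  -- `r δ` bounds the one-slot displacement of `W`. The two conditions allow the quadratic bound on
  -- the exponential and keep its second-order term below a quarter of the slope.
  obtain ⟨θ, hθ, hθd, hθL⟩ : ∃ θ : ℝ, 0 < θ ∧ θ * (r * M.δ) ≤ 1 ∧ θ * (r * M.δ) ^ 2 ≤ L / 4 := by
    refine ⟨min (1 / (r * M.δ)) (L / 4 / (r * M.δ) ^ 2), by positivity, ?_, ?_⟩
    · rw [← le_div_iff₀ hd]; exact min_le_left _ _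
    · rw [← le_div_iff₀ (by positivity)]; exact min_le_right _ _
  set D := 3 * r * M.δ ^ 2 / L with hDdef
  have hD : 0 < D := by positivity
  have hDL : 3 * r * M.δ ^ 2 ≤ L * D := by rw [hDdef, mul_div_cancel₀ _ hL.ne']
  set a := 16 * Real.exp (θ * D) / L with ha
  have ha0 : 0 < a := by positivity
  set C₁ := r * (1 + M.δ + Real.exp (θ * D) / θ) + r / θ * (a * (r * M.δ)) with hC₁
  set C₂ := 3 * r * M.δ ^ 2 / 2 + 2 * M.δ * (a * (r * M.δ)) with hC₂
  set C₃ := r * M.δ * (a * (r * M.δ)) with hC₃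
  set C₄ := r * M.δ * a with hC₄
  have h₁ : 0 ≤ C₁ := by positivity
  have h₂ : 0 ≤ C₂ := by positivity
  have h₃ : 0 ≤ C₃ := by positivity
  have h₄ : 0 ≤ C₄ := by positivity
  -- The threshold makes `log V` at least `1`, `D` and `1/θ`: then constants are absorbed by `log^2
  -- V`, the cutoff `D` lies below `log^2 V`, and `exp (-θ log^2 V) ≤ 1/V`.
  refine ⟨θ, C₁ + C₂ + C₃ + C₄, Real.exp (1 + D + 1 / θ), hθ, Real.one_le_exp (by positivity), ?_⟩
  intro V hV UV hUV Ω _ P _ R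
  have hV0 : 0 < V := (Real.exp_pos _).trans_le hV
  have hlog : 1 + D + 1 / θ ≤ Real.log V := (Real.le_log_iff_exp_le hV0).2 hV
  have hθ' : 0 < 1 / θ := by positivity
  have hlog1 : 1 ≤ Real.log V := by linarith
  have hsq : Real.log V ≤ Real.log V ^ 2 := by nlinarith
  have hDlog : D ≤ Real.log V ^ 2 := by linarith
  have hρ : Real.exp (-(θ * Real.log V ^ 2)) = 1 / V ^ (θ * Real.log V) := by
    rw [Real.rpow_def_of_pos hV0, Real.exp_neg, one_div]
    ring_nf
  have hρV : Real.exp (-(θ * Real.log V ^ 2)) ≤ 1 / V := by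
    rw [Real.exp_neg, ← one_div]
    refine one_div_le_one_div_of_le hV0 ?_
    conv_lhs => rw [← Real.exp_log hV0]
    refine Real.exp_le_exp.2 ?_
    have h1 : 1 ≤ θ * Real.log V := by
      rw [mul_comm, ← div_le_iff₀ hθ]; linarith
    nlinarith
  obtain ⟨hdual, hpolV⟩ := NetworkModel.IsDualOptimal.polyhedral hU₀.1 hL hpol hV0 hUV
  obtain ⟨k, hk⟩ := R.sum_tail_le hUV hL hpolV hθ hD hθd hθL hDL
  -- At most `r δ` packets arrive per slot, so the bound by arrivals implies one linear in time.
  have hk' : ∀ t : ℕ, ∑ τ ∈ Finset.range t, R.tail θ D τ ≤ a * (r * M.δ) * t + k := by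
    intro t
    refine (hk t).trans ?_
    have h1 : ∑ τ ∈ Finset.range t, R.arrived τ ≤ t * (r * M.δ) := by
      refine (Finset.sum_le_sum fun τ _ => R.arrived_le τ).trans_eq (by simp)
    nlinarith
  refine ⟨?_, ?_, ?_, fun htend => ?_⟩
  · refine (R.avgBacklog_le hθ hk').trans (EReal.coe_le_coe_iff.2 ?_)
    have hl : 1 ≤ Real.log V ^ 2 := hlog1.trans hsq
    set X := r * (M.δ + Real.exp (θ * D) / θ) + r / θ * (a * (r * M.δ)) with hX
    have hX0 : 0 ≤ X := by positivity
    calc r * (Real.log V ^ 2 + M.δ + Real.exp (θ * D) / θ) + r / θ * (a * (r * M.δ))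
        = r * Real.log V ^ 2 + X * 1 := by rw [hX]; ring
      _ ≤ r * Real.log V ^ 2 + X * Real.log V ^ 2 := by gcongr
      _ = C₁ * Real.log V ^ 2 := by rw [hC₁, hX]; ring
      _ ≤ _ := by gcongr; linarith
  · refine (R.abs_avgIncurred_sub_optCost_le hU₀.1 hV0 hUV hdual hθ hDlog hk').trans ?_
    have h5 : 2 * M.δ * Real.exp (-(θ * Real.log V ^ 2)) * (a * (r * M.δ)) ≤
        2 * M.δ * (1 / V) * (a * (r * M.δ)) := by gcongr
    calc _ ≤ 3 * r * M.δ ^ 2 / 2 / V + 2 * M.δ * (1 / V) * (a * (r * M.δ)) := by linarith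
      _ = C₂ / V := by rw [hC₂]; ring
      _ ≤ _ := by gcongr; linarith
  · refine (R.dropRate_le hθ hDlog hk').trans ?_
    rw [hρ, mul_one_div]
    gcongr
    linarith
  · refine (R.dropFraction_le hθ hDlog hk htend).trans ?_
    rw [hρ, mul_one_div]
    gcongr
    linarith
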